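/- Let $G$ be an $n$-player normal-form game with finite action sets $\mathcal A_i$ and additively separable utilities, i.e. $u_i(a_1,\dots,a_n)=\sum_j u_{ij}(a_j)$ for some functions $u_{ij}:\mathcal A_j\to\mathbb R$. Let $v=(v_1,\dots,v_n)\in\mathbb R^n$ be a payoff vector which is - feasible without correlation: there are mixed strategies $s_j\in\Delta(\mathcal A_j)$ with $v_i=u_i(s_1,\dots,s_n)$ (expected utility under independent sampling) for all $i$; and - strictly individually rational: $v_i>\min_{s_{-i}\in\prod_{j\ne i}\Delta(\mathcal A_j)}\max_{a_i\in\mathcal A_i}u_i(s_{-i},a_i)$ for all $i$. Then there are a single $\varepsilon\in(0,1)$, computable policies $\pi_1,\dots,\pi_n$ and programs $p_1,\dots,p_n$ such that each $p_i$ is an uncorrelated $\varepsilon$Grounded$\pi_i$Bot, $(p_1,\dots,p_n)$ is a program equilibrium of the uncorrelated program game of $G$, and the expected utility of each player $i$ in this equilibrium is $v_i$. No shared randomness is used. Here the notions are as follows. *Programs* are deterministic programs of a fixed Turing-complete language with exact arithmetic on and comparison of real numbers and arbitrary real constants. Program $i$ receives as input its own source code, the list $p_{-i}$ of the source codes of the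 other programs, and a sequence $(r_m)_{m\ge0}$ of reals, and, if it halts, outputs an action in $\mathcal A_i$; programs can inspect, build and run source code, and $\mathrm{apply}(p,(q,(r'_m)))$ denotes the result of running program $p$ on the list $q$ of programs and the sequence $(r'_m)$. In the *uncorrelated program game*, each player $i$ submits a program $p_i$, and program $i$ is run on $(p_{-i},(r^i_m)_m)$, where $(r^1_m)_m,\dots,(r^n_m)_m$ are independent sequences, each i.i.d. $U[0,1]$. If all the programs halt with probability 1 ("almost surely halt against each other"), the expected utility of player $i$ is $\mathbb E[u_i(A_1,\dots,A_n)]$, where $A_j$ is the output of program $j$. A profile $(p_1,\dots,p_n)$ is a *program equilibrium* if its programs almost surely halt against each other and, for every $i$, $p_i$ maximises the expected utility of player $i$ against $p_{-i}$ among all programs $p_i'$ such that $p_i',p_{-i}$ almost surely halt against each other. A *policy* $\pi_i$ maps a finite action history $a^{1:T}\in(\prod_j\mathcal A_j)^T$, $T\ge0$, and numbers $r_0,\dots,r_T$ to an action of player $i$; it is *computable* if some program of the language computes it. The *uncorrelated $\varepsilon$Grounded$\pi_i$Bot* is the program which, on input $(p_{-i},(r_m))$, computes $T=\min\{t:r_t<\varepsilon\}$,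 then for $t=1,\dots,T$ and all $j=1,\dots,n$ (itself included) simulates $a_j^t=\mathrm{apply}\bigl(p_j,(p_{-j},(r_m)_{m\ge T+1-t})\bigr)$, and outputs $\pi_i(a^{1:T};r_{0:T})$. -/

import Mathlib

open MeasureTheory

namespace ProgramGame

universe u

/-! ## Normal-form games -/

section Games

variable {n : ℕ} {A : Fin n → Type u} [∀ i, Fintype (A i)]

/-- A (mixed) strategy of player `i`: a probability distribution on the finite set `A i`. -/
abbrev Strategy (A : Fin n → Type u) [∀ i, Fintype (A i)] (i : Fin n) : Type u :=
  stdSimplex ℝ (A i)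

open Classical in
/-- The strategy that plays `a` with probability one. -/
noncomputable def pureStrategy {i : Fin n} (a : A i) : Strategy A i :=
  ⟨Pi.single a 1, single_mem_stdSimplex ℝ a⟩

/-- `u_i(s_1, …, s_n)`: the expected utility of player `i` when the players randomise
independently according to the profile `s`. -/
noncomputable def mixedUtility (U : Fin n → (∀ j, A j) → ℝ) (s : ∀ j, Strategy A j)
    (i : Fin n) : ℝ :=
  ∑ a : ∀ j, A j, U i a * ∏ j, (s j).1 (a j)

/-- The minimax utility of player `i`: the minimum over the strategies `s_j` (`j ≠ i`) of the
opponents of the maximum over the actions `a` of player `i` of `u_i(s_{-i}, a)`. The entry `s i`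
of the full profile `s` is overwritten, so it plays no role. -/
noncomputable def minimax (U : Fin n → (∀ j, A j) → ℝ) (i : Fin n) : ℝ :=
  ⨅ s : ∀ j, Strategy A j, ⨆ a : A i, mixedUtility U (Function.update s i (pureStrategy a)) i

/-- `v` is feasible (without correlation). -/
def Feasible (U : Fin n → (∀ j, A j) → ℝ) (v : Fin n → ℝ) : Prop :=
  ∃ s : ∀ j, Strategy A j, ∀ i, v i = mixedUtility U s i

/-- `v` is strictly individually rational. -/
def StrictlyIndividuallyRational (U : Fin n → (∀ j, A j) → ℝ) (v : Fin n → ℝ) : Prop :=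
  ∀ i, minimax U i < v i

end Games

/-- Additively separable utilities: `u_i(a) = ∑ j, u_{ij}(a_j)`. -/
def AdditivelySeparable {n : ℕ} {A : Fin n → Type u} (U : Fin n → (∀ j, A j) → ℝ) : Prop :=
  ∃ w : Fin n → ∀ j, A j → ℝ, ∀ i a, U i a = ∑ j, w i j (a j)

/-! ## The programming language

Programs are written in a small LISP-like language with exact real arithmetic and exact comparison
of reals. Its data are binary trees, and programs are themselves data, so that a program can
inspect, build, store and run programs. -/

/-- The instructions of the language. -/
inductive Op
  /-- the input -/
  | arg
  /-- a constant -/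
  | quote
  /-- first and second component of a pair, and the test for being a pair -/
  | car | cdr | isPair
  /-- pairing -/
  | cons
  /-- tests: equality of data, strict comparison of reals -/
  | eq | lt
  /-- arithmetic on reals -/
  | add | sub | mul | div
  /-- read the entry of the random sequence with a given index (rounded down to a natural number) -/
  | read
  /-- conditional, while-loop -/
  | cond | loop
  /-- run a piece of data as code, on a given input and the current random sequence -/
  | eval
  /-- run a program on given opponent programs and a given random sequence -/
  | app

/-- The data of the language: trees whose leaves are atoms from `α`, reals, instructions or `nil`.
A piece of data is used as code as described at `run`. -/
inductive Data (α : Type u) : Type u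
  | atom (a : α)
  | num (x : ℝ)
  | op (o : Op)
  | nil
  | cons (x y : Data α)

namespace Data

variable {α : Type u}

/-- Truth values: `nil` is false, everything else is true. -/
noncomputable def ofBool (b : Bool) : Data α := if b then num 1 else nil

def car? : Data α → Option (Data α)
  | cons x _ => some x
  | _ => none

def cdr? : Data α → Option (Data α)
  | cons _ y => some y
  | _ => none

noncomputable def isPair : Data α → Data α
  | cons _ _ => ofBool true
  | _ => ofBool false

def num? : Data α → Option ℝ
  | num x => some x
  | _ => none

/-- Apply `f` to two reals; there is no result for other data. -/
def onNums (f : ℝ → ℝ → Option (Data α)) : Data α → Data α → Option (Data α)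
  | num x, num y => f x y
  | _, _ => none

/-- The list `x₁, …, x_k` as `cons x₁ (… (cons x_k nil))`. -/
def ofList (l : List (Data α)) : Data α := l.foldr cons nil

end Data

open Classical in
/-- `run k r c x` runs the code `c` on the input `x` with the random sequence `r`, with recursion
depth at most `k`; the result is `none` if no result is reached within this depth (in particular
if the code is malformed or an operation is applied outside its domain). The entries `r m` are
options since a sequence that a program hands to a program it simulates is computed on demand, and
the computation of an entry may fail to halt.

`app f g s` runs the program given by `f` on the list of opponents given by `g` and on the sequence
whose `m`-th entry is computed by `s` from `m` and the current input. As always, the program that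
is run has access to its own source: its input is the pair of its own source and the list of its
opponents. -/
noncomputable def run {α : Type u} :
    ℕ → (ℕ → Option ℝ) → Data α → Data α → Option (Data α)
  | 0, _, _, _ => none
  | k + 1, r, c, x =>
    match c with
    | .op .arg => some x
    | .cons (.op .quote) d => some d
    | .cons (.op .car) f => (run k r f x).bind Data.car?
    | .cons (.op .cdr) f => (run k r f x).bind Data.cdr?
    | .cons (.op .isPair) f => (run k r f x).map Data.isPair
    | .cons (.op .cons) (.cons f g) =>
        (run k r f x).bind fun a => (run k r g x).bind fun b => some (.cons a b)
    | .cons (.op .eq) (.cons f g) =>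
        (run k r f x).bind fun a => (run k r g x).bind fun b => some (.ofBool (decide (a = b)))
    | .cons (.op .lt) (.cons f g) =>
        (run k r f x).bind fun a => (run k r g x).bind fun b =>
          Data.onNums (fun y z => some (.ofBool (decide (y < z)))) a b
    | .cons (.op .add) (.cons f g) =>
        (run k r f x).bind fun a => (run k r g x).bind fun b =>
          Data.onNums (fun y z => some (.num (y + z))) a b
    | .cons (.op .sub) (.cons f g) =>
        (run k r f x).bind fun a => (run k r g x).bind fun b =>
          Data.onNums (fun y z => some (.num (y - z))) a b
    | .cons (.op .mul) (.cons f g) =>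
        (run k r f x).bind fun a => (run k r g x).bind fun b =>
          Data.onNums (fun y z => some (.num (y * z))) a b
    | .cons (.op .div) (.cons f g) =>
        (run k r f x).bind fun a => (run k r g x).bind fun b =>
          Data.onNums (fun y z => if z = 0 then none else some (.num (y / z))) a b
    | .cons (.op .read) f =>
        (run k r f x).bind fun a => a.num?.bind fun t => (r ⌊t⌋₊).map .num
    | .cons (.op .cond) (.cons b (.cons f g)) =>
        (run k r b x).bind fun t => if t = .nil then run k r g x else run k r f x
    | .cons (.op .loop) (.cons b f) =>
        (run k r b x).bind fun t =>
          if t = .nil then some x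
          else (run k r f x).bind fun y => run k r (.cons (.op .loop) (.cons b f)) y
    | .cons (.op .eval) (.cons f g) =>
        (run k r f x).bind fun a => (run k r g x).bind fun b => run k r a b
    | .cons (.op .app) (.cons f (.cons g s)) =>
        (run k r f x).bind fun p => (run k r g x).bind fun q =>
          run k (fun m => (run k r s (.cons (.num m) x)).bind Data.num?) p (.cons p q)
    | _ => none

/-! ## Uncorrelated program games -/

section Programs

variable {n : ℕ}

/-- Programs for a game with action sets `A i`; the actions of the players are atoms. Every piece
of data is a program; malformed ones do not halt. -/
abbrev Program (A : Fin n → Type u) : Type u := Data (Σ i, A i)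

variable {A : Fin n → Type u}

/-- The list of the programs `p j`, `j ≠ i`, in increasing order of `j`. -/
def opponents (p : Fin n → Program A) (i : Fin n) : Program A :=
  Data.ofList (((List.finRange n).filter (fun j => j ≠ i)).map p)

/-- `apply(p_i, (p_{-i}, r))` halts with the action `a` of player `i`. -/
def Outputs (p : Fin n → Program A) (i : Fin n) (r : ℕ → ℝ) (a : A i) : Prop :=
  ∃ k, run k (fun m => some (r m)) (p i) (.cons (p i) (opponents p i)) = some (.atom ⟨i, a⟩)

instance uniformProbability :
    IsProbabilityMeasure ((volume : Measure ℝ).restrict (Set.Icc 0 1)) :=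
  ⟨by simp⟩

/-- The law of an i.i.d. sequence of `U[0,1]` random variables. -/
noncomputable def seqLaw : Measure (ℕ → ℝ) :=
  Measure.infinitePi fun _ => (volume : Measure ℝ).restrict (Set.Icc 0 1)

instance : IsProbabilityMeasure seqLaw := by unfold seqLaw; infer_instance

/-- The programs `p` almost surely halt against each other. -/
def HaltAgainstEachOther (p : Fin n → Program A) : Prop :=
  ∀ i, ∀ᵐ r ∂seqLaw, ∃ a : A i, Outputs p i r a

/-- The probability of the outcome `a` if player `i` submits `p i`, where program `i` receives its
own random sequence `ω i`, and these sequences are independent. -/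
noncomputable def outcomeProb (p : Fin n → Program A) (a : ∀ i, A i) : ℝ :=
  (Measure.pi fun _ : Fin n => seqLaw).real {ω | ∀ i, Outputs p i (ω i) (a i)}

/-- The expected utility of player `i` in the uncorrelated program game. -/
noncomputable def expectedUtility [∀ i, Fintype (A i)] (U : Fin n → (∀ j, A j) → ℝ)
    (p : Fin n → Program A) (i : Fin n) : ℝ :=
  ∑ a : ∀ j, A j, outcomeProb p a * U i a

/-- `p` is a program equilibrium of the uncorrelated program game: the programs almost surely halt
against each other, and every `p i` maximises the expected utility of player `i` among the programs
`p'` such that `p'` and the `p j`, `j ≠ i`, almost surely halt against each other. -/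
def IsProgramEquilibrium [∀ i, Fintype (A i)] (U : Fin n → (∀ j, A j) → ℝ)
    (p : Fin n → Program A) : Prop :=
  HaltAgainstEachOther p ∧
    ∀ (i : Fin n) (p' : Program A), HaltAgainstEachOther (Function.update p i p') →
      expectedUtility U (Function.update p i p') i ≤ expectedUtility U p i

/-! ## Uncorrelated `ε`-grounded `π`-bots -/

/-- A policy of player `i`: it maps an action history `a^1, …, a^T` (in chronological order) and
the numbers `r_0, …, r_T` to an action. -/
abbrev Policy (A : Fin n → Type u) (i : Fin n) : Type u :=
  List (∀ j, A j) → List ℝ → A i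

/-- An action profile as data. -/
def profileData (a : ∀ j, A j) : Program A :=
  Data.ofList ((List.finRange n).map fun j => .atom ⟨j, a j⟩)

/-- A history as data, the most recent action profile first. -/
def historyData (h : List (∀ j, A j)) : Program A :=
  Data.ofList (h.reverse.map profileData)

/-- The code `c` computes the policy `π`. Since `r` is arbitrary, the random sequence
is of no use to `c` apart from the numbers `r_0, …, r_T` which are part of the input. -/
def ComputesPolicy {i : Fin n} (c : Program A) (π : Policy A i) : Prop :=
  ∀ (r : ℕ → Option ℝ) (h : List (∀ j, A j)) (rs : List ℝ), rs.length = h.length + 1 →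
    ∃ k, run k r c (.cons (historyData h) (Data.ofList (rs.map .num))) = some (.atom ⟨i, π h rs⟩)

end Programs

/-! Code fragments. Below, `x` stands for the current input. -/

namespace Code

variable {α : Type u}

def arg : Data α := .op .arg
def quote (d : Data α) : Data α := .cons (.op .quote) d
def car (f : Data α) : Data α := .cons (.op .car) f
def cdr (f : Data α) : Data α := .cons (.op .cdr) f
def cons (f g : Data α) : Data α := .cons (.op .cons) (.cons f g)
def lt (f g : Data α) : Data α := .cons (.op .lt) (.cons f g)
def add (f g : Data α) : Data α := .cons (.op .add) (.cons f g)
def sub (f g : Data α) : Data α := .cons (.op .sub) (.cons f g)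
def read (f : Data α) : Data α := .cons (.op .read) f
def cond (b f g : Data α) : Data α := .cons (.op .cond) (.cons b (.cons f g))
def loop (b f : Data α) : Data α := .cons (.op .loop) (.cons b f)
def eval (f g : Data α) : Data α := .cons (.op .eval) (.cons f g)
def app (f g s : Data α) : Data α := .cons (.op .app) (.cons f (.cons g s))

/-- Run `g`, then `f` on the result. -/
def comp (f g : Data α) : Data α := eval (quote f) g

/-- The list of the results of the pieces of code in `l`. -/
def list (l : List (Data α)) : Data α := l.foldr cons (quote .nil)

/-- The entry number `k` of the list computed by `f`. -/
def nth (k : ℕ) (f : Data α) : Data α := car (cdr^[k] f)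

end Code

namespace GroundedBot

open Code

variable {n : ℕ} {A : Fin n → Type u}

/-- `T ← min {t : r_t < ε}` -/
noncomputable def findT (ε : ℝ) : Program A :=
  comp (loop (cond (lt (read arg) (quote (.num ε))) (quote .nil) (quote (.num 1)))
    (add arg (quote (.num 1)))) (quote (.num 0))

/-- The program `p_j`, read off from the input `z = (p_i, p_{-i})` of program `i`. -/
def prog (i : Fin n) (z : Program A) (j : Fin n) : Program A :=
  if j < i then nth j (cdr z) else if j = i then car z else nth (j - 1) (cdr z)

/-- The list `p_{-j}`, read off from the input `z = (p_i, p_{-i})` of program `i`. -/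
def opps (i : Fin n) (z : Program A) (j : Fin n) : Program A :=
  list (((List.finRange n).filter (fun k => k ≠ j)).map (prog i z))

/-! The state of the main loop is `(s, (hist, (rs, z)))`, where `s` is the number of initial
entries of the random sequence to be removed in the next round of simulations, `hist` is the action
history found so far (the most recent action profile first), `rs` is the list `r_s, …, r_T`, and
`z = (p_i, p_{-i})` is the input of the program. -/

def stS : Program A := car arg
def stHist : Program A := car (cdr arg)
def stRs : Program A := car (cdr (cdr arg))
def stInput : Program A := cdr (cdr (cdr arg))

/-- `apply(p_j, (p_{-j}, (r_m)_{m ≥ s}))`; in the third argument of `app`, the current input is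
the pair of `m` and the state. -/
def simulate (i j : Fin n) : Program A :=
  app (prog i stInput j) (opps i stInput j) (read (add (car arg) (car (cdr arg))))

/-- One round of simulations: all programs are run with `s` initial entries removed. -/
noncomputable def round (i : Fin n) : Program A :=
  cons (sub stS (quote (.num 1)))
    (cons (cons (list ((List.finRange n).map (simulate i))) stHist)
      (cons (cons (read (sub stS (quote (.num 1)))) stRs) stInput))

/-- The initial state `(T, ((), ((r_T), z)))`. -/
noncomputable def start (ε : ℝ) : Program A :=
  comp (cons (car arg) (cons (quote .nil) (cons (list [read (car arg)]) (cdr arg))))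
    (cons (findT ε) arg)

end GroundedBot

open Code GroundedBot in
/-- The uncorrelated `ε`-grounded `π`-bot of player `i`, where `c` is code for the policy `π`:
on input `(p_{-i}, (r_m))` it computes `T = min {t : r_t < ε}`, then for `t = 1, …, T` the actions
`a_j^t = apply(p_j, (p_{-j}, (r_m)_{m ≥ T + 1 - t}))` of all players `j` (itself included), and it
returns `π(a^1, …, a^T; r_0, …, r_T)`. -/
noncomputable def groundedBot {n : ℕ} {A : Fin n → Type u} (ε : ℝ) (i : Fin n) (c : Program A) :
    Program A :=
  comp (eval (quote c) (cons stHist stRs))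
    (comp (loop (lt (quote (.num 0)) stS) (round i)) (start ε))

/-- `p` is an uncorrelated `ε`-grounded `π`-bot of player `i`, with a computable policy `π`. -/
def IsGroundedBot {n : ℕ} {A : Fin n → Type u} (ε : ℝ) {i : Fin n} (π : Policy A i)
    (p : Program A) : Prop :=
  ∃ c : Program A, ComputesPolicy c π ∧ p = groundedBot ε i c

end ProgramGame

/-! Player `j` realises the mixed strategy `s j` as a function `f j` of the leading random number. A
grounded bot feeds one and the same sequence to all programs it simulates, so each simulated action
can be compared with the one that `f` prescribes, and deviations become visible. The policy is grim
trigger: follow `f` unless the simulated history contains a deviation; otherwise use the action that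
is worst for the earliest deviator. Simulations drop entries of the sequence, so the mutual
recursion ends once some entry is below `ε`, which happens almost surely (`ae_exists_lt`). On the
equilibrium path everybody follows `f` (`outputs_of_grimBots`).

In the actual game the sequences are independent, so the players do not punish at the same time.
Separability removes this difficulty: expected utility depends only on the marginal laws of the
actions, hence may be computed as if all programs read one common sequence
(`expectedUtility_eq_integral`). It also lets each opponent minimise its own contribution `w i j`,
so the punishment payoff `m` is at most the minimax value (`le_minimax`) and `m < v`.

On the common sequence, let `Y` be the event that player `i` departs from `f`, `X` the event that
some simulation lands in `Y`, and `Z = Y ∪ X`. The others punish exactly on `X`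
(`foldl_grimUpdate_grimPlay`). As `X` says that `r 0 ≥ ε` and that the shifted sequence is in `Z`,
independence gives `P(X) = (1 - ε) P(Z)`, so an unpunished deviation has probability only `ε P(Z)`.
The gain is at most `ε M P(Z)`, the loss at least `(v - m - ε C) P(Z)`, and a small `ε` makes
deviating unprofitable (`integral_le_of_punishment`).

The deviating program is arbitrary, so its output must be shown to be a measurable function of the
sequence; this rests on the measurability of the whole interpreter (`PMeasurable.run`). -/

namespace ProgramGame

universe u

/-! ## Big-step semantics of the language -/

section Semantics

variable {α : Type u}

/-- Results persist when the recursion depth is increased and the random sequence is extended. -/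
theorem run_mono {k k' : ℕ} (hk : k ≤ k') {r r' : ℕ → Option ℝ}
    (hr : ∀ m y, r m = some y → r' m = some y) {c x y : Data α} (h : run k r c x = some y) :
    run k' r' c x = some y := by
  induction k generalizing k' r r' c x y with
  | zero => simp [run] at h
  | succ k ih =>
    obtain ⟨k', rfl⟩ : ∃ l, k' = l + 1 := ⟨k' - 1, by omega⟩
    have hk : k ≤ k' := by omega
    have ih' : ∀ {c x y : Data α}, run k r c x = some y → run k' r' c x = some y :=
      fun h => ih hk hr h
    unfold run at h ⊢
    split at h
    · exact h
    · exact h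
    · simp only [Option.bind_eq_some_iff] at h ⊢
      obtain ⟨a, ha, h⟩ := h
      exact ⟨a, ih' ha, h⟩
    · simp only [Option.bind_eq_some_iff] at h ⊢
      obtain ⟨a, ha, h⟩ := h
      exact ⟨a, ih' ha, h⟩
    · simp only [Option.map_eq_some_iff] at h ⊢
      obtain ⟨a, ha, h⟩ := h
      exact ⟨a, ih' ha, h⟩
    -- The seven binary instructions: `cons`, `eq`, `lt` and the four arithmetic ones.
    iterate 7
      · simp only [Option.bind_eq_some_iff] at h ⊢
        obtain ⟨a, ha, b, hb, h⟩ := h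
        exact ⟨a, ih' ha, b, ih' hb, h⟩
    · simp only [Option.bind_eq_some_iff, Option.map_eq_some_iff] at h ⊢
      obtain ⟨a, ha, t, ht, z, hz, h⟩ := h
      exact ⟨a, ih' ha, t, ht, z, hr _ _ hz, h⟩
    · simp only [Option.bind_eq_some_iff] at h ⊢
      obtain ⟨a, ha, h⟩ := h
      refine ⟨a, ih' ha, ?_⟩
      split_ifs at h ⊢
      · exact ih' h
      · exact ih' h
    · simp only [Option.bind_eq_some_iff] at h ⊢
      obtain ⟨a, ha, h⟩ := h
      refine ⟨a, ih' ha, ?_⟩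
      split_ifs at h ⊢
      · exact h
      · simp only [Option.bind_eq_some_iff] at h ⊢
        obtain ⟨b, hb, h⟩ := h
        exact ⟨b, ih' hb, ih' h⟩
    · simp only [Option.bind_eq_some_iff] at h ⊢
      obtain ⟨a, ha, b, hb, h⟩ := h
      exact ⟨a, ih' ha, b, ih' hb, ih' h⟩
    · simp only [Option.bind_eq_some_iff] at h ⊢
      obtain ⟨a, ha, b, hb, h⟩ := h
      -- A larger depth also makes more entries of the sequence handed to the simulated program
      -- available; this is why the induction must allow the sequence to be extended.
      refine ⟨a, ih' ha, b, ih' hb, ih hk ?_ h⟩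
      intro m y hy
      simp only [Option.bind_eq_some_iff] at hy ⊢
      obtain ⟨a, ha, hy⟩ := hy
      exact ⟨a, ih' ha, hy⟩
    · simp at h

/-- The code `c` evaluates to `y` on the input `x`, with the random sequence `r`. -/
def Evaluates (r : ℕ → Option ℝ) (c x y : Data α) : Prop := ∃ k, run k r c x = some y

theorem Evaluates.unique {r : ℕ → Option ℝ} {c x y z : Data α} (hy : Evaluates r c x y)
    (hz : Evaluates r c x z) : y = z := by
  obtain ⟨k, hk⟩ := hy
  obtain ⟨l, hl⟩ := hz
  have h1 := run_mono (le_max_left k l) (fun _ _ h => h) hk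
  have h2 := run_mono (le_max_right k l) (fun _ _ h => h) hl
  exact Option.some_injective _ (h1.symm.trans h2)

/-- Finitely many evaluations can be carried out within a common recursion depth. -/
theorem Evaluates.exists_common {r : ℕ → Option ℝ} {c x y c' x' y' : Data α}
    (h : Evaluates r c x y) (h' : Evaluates r c' x' y') :
    ∃ k, run k r c x = some y ∧ run k r c' x' = some y' := by
  obtain ⟨k, hk⟩ := h
  obtain ⟨l, hl⟩ := h'
  exact ⟨max k l, run_mono (le_max_left k l) (fun _ _ h => h) hk,
    run_mono (le_max_right k l) (fun _ _ h => h) hl⟩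

namespace Evaluates

variable {r : ℕ → Option ℝ} {x : Data α}

open Code

theorem arg : Evaluates r Code.arg x x := ⟨1, by simp [run, Code.arg]⟩

theorem quote (d : Data α) : Evaluates r (quote d) x d := ⟨1, by simp [run, Code.quote]⟩

theorem car {f a b : Data α} (h : Evaluates r f x (.cons a b)) : Evaluates r (car f) x a := by
  obtain ⟨k, h⟩ := h
  exact ⟨k + 1, by simp [run, Code.car, h, Data.car?]⟩

theorem cdr {f a b : Data α} (h : Evaluates r f x (.cons a b)) : Evaluates r (cdr f) x b := by
  obtain ⟨k, h⟩ := h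
  exact ⟨k + 1, by simp [run, Code.cdr, h, Data.cdr?]⟩

theorem isPair {f a : Data α} (h : Evaluates r f x a) :
    Evaluates r (.cons (.op .isPair) f) x a.isPair := by
  obtain ⟨k, h⟩ := h
  exact ⟨k + 1, by simp [run, h]⟩

theorem cons {f g a b : Data α} (hf : Evaluates r f x a) (hg : Evaluates r g x b) :
    Evaluates r (cons f g) x (.cons a b) := by
  obtain ⟨k, hf, hg⟩ := hf.exists_common hg
  exact ⟨k + 1, by simp [run, Code.cons, hf, hg]⟩

open Classical in
theorem eq {f g a b : Data α} (hf : Evaluates r f x a) (hg : Evaluates r g x b) :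
    Evaluates r (.cons (.op .eq) (.cons f g)) x (.ofBool (decide (a = b))) := by
  obtain ⟨k, hf, hg⟩ := hf.exists_common hg
  exact ⟨k + 1, by simp [run, hf, hg]⟩

open Classical in
theorem lt {f g : Data α} {y z : ℝ} (hf : Evaluates r f x (.num y))
    (hg : Evaluates r g x (.num z)) :
    Evaluates r (lt f g) x (.ofBool (decide (y < z))) := by
  obtain ⟨k, hf, hg⟩ := hf.exists_common hg
  exact ⟨k + 1, by simp [run, Code.lt, hf, hg, Data.onNums]⟩

theorem add {f g : Data α} {y z : ℝ} (hf : Evaluates r f x (.num y))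
    (hg : Evaluates r g x (.num z)) : Evaluates r (add f g) x (.num (y + z)) := by
  obtain ⟨k, hf, hg⟩ := hf.exists_common hg
  exact ⟨k + 1, by simp [run, Code.add, hf, hg, Data.onNums]⟩

theorem sub {f g : Data α} {y z : ℝ} (hf : Evaluates r f x (.num y))
    (hg : Evaluates r g x (.num z)) : Evaluates r (sub f g) x (.num (y - z)) := by
  obtain ⟨k, hf, hg⟩ := hf.exists_common hg
  exact ⟨k + 1, by simp [run, Code.sub, hf, hg, Data.onNums]⟩

theorem read {f : Data α} {m : ℕ} {y : ℝ} (hf : Evaluates r f x (.num m)) (hr : r m = some y) :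
    Evaluates r (read f) x (.num y) := by
  obtain ⟨k, hf⟩ := hf
  exact ⟨k + 1, by simp [run, Code.read, hf, Data.num?, hr]⟩

theorem cond_true {b f g t y : Data α} (hb : Evaluates r b x t) (ht : t ≠ .nil)
    (hf : Evaluates r f x y) : Evaluates r (cond b f g) x y := by
  obtain ⟨k, hb, hf⟩ := hb.exists_common hf
  exact ⟨k + 1, by simp [run, Code.cond, hb, ht, hf]⟩

theorem cond_false {b f g y : Data α} (hb : Evaluates r b x .nil)
    (hg : Evaluates r g x y) : Evaluates r (cond b f g) x y := by
  obtain ⟨k, hb, hg⟩ := hb.exists_common hg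
  exact ⟨k + 1, by simp [run, Code.cond, hb, hg]⟩

theorem cond_ofBool {b f g y z : Data α} {t : Prop} [Decidable t]
    (hb : Evaluates r b x (.ofBool (decide t)))
    (hf : t → Evaluates r f x y) (hg : ¬ t → Evaluates r g x z) :
    Evaluates r (cond b f g) x (if t then y else z) := by
  by_cases h : t
  · rw [if_pos h]
    exact cond_true hb (by simp [Data.ofBool, h]) (hf h)
  · rw [if_neg h]
    exact cond_false (by simpa [Data.ofBool, h] using hb) (hg h)

theorem loop_done {b f : Data α} (hb : Evaluates r b x .nil) : Evaluates r (loop b f) x x := by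
  obtain ⟨k, hb⟩ := hb
  exact ⟨k + 1, by simp [run, Code.loop, hb]⟩

theorem loop_step {b f t y z : Data α} (hb : Evaluates r b x t) (ht : t ≠ .nil)
    (hf : Evaluates r f x y) (h : Evaluates r (loop b f) y z) : Evaluates r (loop b f) x z := by
  obtain ⟨k, hb, hf⟩ := hb.exists_common hf
  obtain ⟨l, hl⟩ := h
  refine ⟨max k l + 1, ?_⟩
  have h1 := run_mono (le_max_left k l) (fun _ _ h => h) hb
  have h2 := run_mono (le_max_left k l) (fun _ _ h => h) hf
  have h3 := run_mono (le_max_right k l) (fun _ _ h => h) hl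
  simp only [Code.loop] at h3
  simp [run, Code.loop, h1, h2, h3, ht]

theorem eval {f g a b y : Data α} (hf : Evaluates r f x a) (hg : Evaluates r g x b)
    (h : Evaluates r a b y) : Evaluates r (eval f g) x y := by
  obtain ⟨k, hf, hg⟩ := hf.exists_common hg
  obtain ⟨l, hl⟩ := h
  refine ⟨max k l + 1, ?_⟩
  have h1 := run_mono (le_max_left k l) (fun _ _ h => h) hf
  have h2 := run_mono (le_max_left k l) (fun _ _ h => h) hg
  have h3 := run_mono (le_max_right k l) (fun _ _ h => h) hl
  simp [run, Code.eval, h1, h2, h3]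

theorem comp {f g b y : Data α} (hg : Evaluates r g x b) (h : Evaluates r f b y) :
    Evaluates r (comp f g) x y := (quote f).eval hg h

/-- `run` computes all entries of the simulated sequence within the same depth as the simulated
program, so one bound `K` is required for all `m`. -/
theorem app {f g s p q y : Data α} {r' : ℕ → ℝ} {K : ℕ} (hf : Evaluates r f x p)
    (hg : Evaluates r g x q) (hs : ∀ m : ℕ, run K r s (.cons (.num m) x) = some (.num (r' m)))
    (h : Evaluates (fun m => some (r' m)) p (.cons p q) y) : Evaluates r (app f g s) x y := by
  obtain ⟨k, hf, hg⟩ := hf.exists_common hg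
  obtain ⟨l, hl⟩ := h
  refine ⟨max K (max k l) + 1, ?_⟩
  have h0 := fun m => run_mono (le_max_left K (max k l)) (fun _ _ h => h) (hs m)
  have h1 := run_mono ((le_max_left k l).trans (le_max_right K _)) (fun _ _ h => h) hf
  have h2 := run_mono ((le_max_left k l).trans (le_max_right K _)) (fun _ _ h => h) hg
  have h3 := run_mono ((le_max_right k l).trans (le_max_right K _)) (fun _ _ h => h) hl
  simp [run, Code.app, h0, h1, h2, h3, Data.num?]

theorem list_map {β : Type*} {l : List β} {f g : β → Data α}
    (h : ∀ b ∈ l, Evaluates r (f b) x (g b)) :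
    Evaluates r (Code.list (l.map f)) x (Data.ofList (l.map g)) := by
  induction l with
  | nil => exact quote _
  | cons c l ih =>
    exact (h c (by simp)).cons (ih fun c hc => h c (by simp [hc]))

theorem nth {f : Data α} {l : List (Data α)} (hf : Evaluates r f x (Data.ofList l)) {k : ℕ}
    {d : Data α} (hd : l[k]? = some d) : Evaluates r (nth k f) x d := by
  induction k generalizing f l with
  | zero =>
    cases l with
    | nil => simp at hd
    | cons a l =>
      simp only [List.length_cons, Nat.zero_lt_succ, List.getElem?_eq_getElem,
        List.getElem_cons_zero, Option.some.injEq] at hd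
      subst hd
      exact hf.car
  | succ k ih =>
    cases l with
    | nil => simp at hd
    | cons a l =>
      simp only [List.getElem?_cons_succ] at hd
      exact ih (f := Code.cdr f) hf.cdr hd

end Evaluates

end Semantics

/-! ## Behaviour of the grounded bots -/

section Bots

open Code GroundedBot

variable {n : ℕ} {A : Fin n → Type u}

theorem filter_ne_finRange (i : Fin n) :
    (List.finRange n).filter (fun j => j ≠ i) = (List.finRange n).eraseIdx i := by
  rw [← List.erase_eq_eraseIdx_of_idxOf (a := i) (by simp),
    (List.nodup_finRange n).erase_eq_filter i]
  congr 1
  ext j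
  by_cases hj : j = i <;> simp [hj]

theorem evaluates_prog {r : ℕ → Option ℝ} {x z : Program A} (p : Fin n → Program A) (i j : Fin n)
    (hz : Evaluates r z x (.cons (p i) (opponents p i))) :
    Evaluates r (prog i z j) x (p j) := by
  have hl : Evaluates r (cdr z) x (opponents p i) := hz.cdr
  unfold opponents at hl
  rw [filter_ne_finRange] at hl
  unfold prog
  split_ifs with h1 h2
  · refine hl.nth ?_
    rw [List.getElem?_map, List.getElem?_eraseIdx, if_pos (by exact_mod_cast h1)]
    simp
  · subst h2
    exact hz.car
  -- Omitting `p i` from the list moves the later programs one place to the left.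
  · refine hl.nth ?_
    have h3 : (i : ℕ) < j := by
      have := lt_of_le_of_ne (not_lt.1 h1) (Ne.symm h2)
      exact_mod_cast this
    rw [List.getElem?_map, List.getElem?_eraseIdx, if_neg (by omega),
      Nat.sub_add_cancel (by omega)]
    simp

theorem evaluates_opps {r : ℕ → Option ℝ} {x z : Program A} (p : Fin n → Program A) (i j : Fin n)
    (hz : Evaluates r z x (.cons (p i) (opponents p i))) :
    Evaluates r (opps i z j) x (opponents p j) :=
  Evaluates.list_map fun k _ => evaluates_prog p i k hz

/-- The sequence `r` without its first `s` entries. -/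
def shift (s : ℕ) (r : ℕ → ℝ) : ℕ → ℝ := fun m => r (m + s)

/-- The state of the main loop of the grounded bot of player `i` before the simulations with `s`
initial entries removed, if `b t` is the action profile simulated with `t` entries removed. -/
noncomputable def loopState (p : Fin n → Program A) (i : Fin n) (r : ℕ → ℝ) (T : ℕ)
    (b : ℕ → ∀ j, A j) (s : ℕ) : Program A :=
  .cons (.num s) (.cons (.ofList ((List.range' (s + 1) (T - s)).map fun t => profileData (b t)))
    (.cons (.ofList ((List.range' s (T + 1 - s)).map fun t => .num (r t)))
      (.cons (p i) (opponents p i))))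

/-- The loop invariant: a round prepends the profile simulated with `s + 1` entries removed and the
number `r s`, so both lists stay sorted with the most recent period in front. -/
theorem evaluates_round {p : Fin n → Program A} {i : Fin n} {r : ℕ → ℝ} {T s : ℕ}
    {b : ℕ → ∀ j, A j} (hs : s < T)
    (hb : ∀ j, Outputs p j (shift (s + 1) r) (b (s + 1) j)) :
    Evaluates (fun m => some (r m)) (round i) (loopState p i r T b (s + 1))
      (loopState p i r T b s) := by
  set x := loopState p i r T b (s + 1) with hx
  have hS : Evaluates (fun m => some (r m)) stS x (.num ((s + 1 : ℕ) : ℝ)) := Evaluates.arg.car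
  have hS' : Evaluates (fun m => some (r m)) (sub stS (quote (.num 1))) x (.num (s : ℝ)) := by
    have := hS.sub (.quote (.num 1))
    simpa using this
  have hI : Evaluates (fun m => some (r m)) stInput x (.cons (p i) (opponents p i)) :=
    Evaluates.arg.cdr.cdr.cdr
  have hsim : ∀ j ∈ List.finRange n, Evaluates (fun m => some (r m)) (simulate i j) x
      (.atom ⟨j, b (s + 1) j⟩) := by
    intro j _
    -- The code for an entry is a fixed loop-free expression, so depth 6 suffices for every `m`.
    refine Evaluates.app (K := 6) (evaluates_prog p i j hI) (evaluates_opps p i j hI) ?_ (hb j)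
    intro m
    have hm : ⌊(m : ℝ) + ((s : ℝ) + 1)⌋₊ = m + (s + 1) := by
      have : (m : ℝ) + ((s : ℝ) + 1) = ((m + (s + 1) : ℕ) : ℝ) := by push_cast; ring
      rw [this, Nat.floor_natCast]
    simp [hx, loopState, Code.read, Code.add, Code.car, Code.cdr, Code.arg, run, Data.car?,
      Data.cdr?, Data.onNums, Data.num?, hm, shift]
  have h1 := Evaluates.list_map hsim
  have h2 : Evaluates (fun m => some (r m)) stHist x _ := Evaluates.arg.cdr.car
  have h3 : Evaluates (fun m => some (r m)) stRs x _ := Evaluates.arg.cdr.cdr.car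
  have h4 := (hS'.cons ((h1.cons h2).cons ((hS'.read rfl).cons h3 |>.cons hI)))
  unfold GroundedBot.round
  convert h4 using 1
  unfold loopState
  rw [show T - s = (T - (s + 1)) + 1 by omega, show T + 1 - s = (T + 1 - (s + 1)) + 1 by omega,
    List.range'_succ, List.range'_succ]
  rfl

theorem evaluates_main_loop {p : Fin n → Program A} {i : Fin n} {r : ℕ → ℝ} {T : ℕ}
    {b : ℕ → ∀ j, A j} (hb : ∀ s < T, ∀ j, Outputs p j (shift (s + 1) r) (b (s + 1) j))
    {s : ℕ} (hs : s ≤ T) :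
    Evaluates (fun m => some (r m)) (loop (lt (quote (.num 0)) stS) (round i))
      (loopState p i r T b s) (loopState p i r T b 0) := by
  induction s with
  | zero =>
    refine Evaluates.loop_done ?_
    have h := Evaluates.lt (r := fun m => some (r m)) (x := loopState p i r T b 0)
      (.quote (.num 0)) (Evaluates.arg.car : Evaluates _ stS _ _)
    simpa [Data.ofBool, stS] using h
  | succ s ih =>
    have h := Evaluates.lt (r := fun m => some (r m)) (x := loopState p i r T b (s + 1))
      (.quote (.num 0)) (Evaluates.arg.car : Evaluates _ stS _ _)
    refine Evaluates.loop_step h ?_ (evaluates_round hs (hb s hs)) (ih (by omega))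
    have : (0 : ℝ) < (s : ℝ) + 1 := by positivity
    simp [Data.ofBool, this]

theorem evaluates_findT {ε : ℝ} {r : ℕ → ℝ} {T : ℕ} (hT : r T < ε) (hlt : ∀ t < T, ε ≤ r t)
    (x : Program A) : Evaluates (fun m => some (r m)) (findT ε) x (.num T) := by
  refine Evaluates.comp (.quote _) ?_
  -- Induction on the number `k` of iterations that remain when the counter is at `T - k`.
  suffices h : ∀ k ≤ T, Evaluates (fun m => some (r m))
      (loop (cond (lt (read Code.arg) (quote (.num ε))) (quote .nil) (quote (.num 1)))
        (add Code.arg (quote (.num 1)))) (.num ((T - k : ℕ) : ℝ) : Program A) (.num T) by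
    simpa using h T le_rfl
  have hcond : ∀ t : ℕ, Evaluates (fun m => some (r m))
      (cond (lt (read Code.arg) (quote (.num ε))) (quote .nil) (quote (.num 1)))
        (.num t : Program A) (if r t < ε then .nil else .num 1) := fun t => by
    classical
    exact Evaluates.cond_ofBool ((Evaluates.arg.read rfl).lt (.quote _)) (fun _ => .quote _)
      fun _ => .quote _
  intro k hk
  induction k with
  | zero =>
    have h := hcond T
    rw [if_pos hT] at h
    simpa using Evaluates.loop_done h
  | succ k ih =>
    have h := hcond (T - (k + 1))
    rw [if_neg (not_lt.2 (hlt _ (by omega)))] at h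
    refine Evaluates.loop_step h (by simp) (Evaluates.arg.add (.quote _)) ?_
    have e : ((T - (k + 1) : ℕ) : ℝ) + 1 = ((T - k : ℕ) : ℝ) := by
      rw [← Nat.cast_succ]; congr 1; omega
    rw [e]
    exact ih (by omega)

/-- If the simulations carried out by a grounded bot halt with the action profiles `b 1, …, b T`,
where `b s` results when the first `s` entries of the random sequence are removed, then the bot
outputs the action that its policy assigns to this history. -/
theorem outputs_groundedBot {ε : ℝ} {i : Fin n} {c : Program A} {π : Policy A i}
    (hc : ComputesPolicy c π) {p : Fin n → Program A} (hp : p i = groundedBot ε i c)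
    {r : ℕ → ℝ} {T : ℕ} (hT : r T < ε) (hlt : ∀ t < T, ε ≤ r t) {b : ℕ → ∀ j, A j}
    (hb : ∀ s < T, ∀ j, Outputs p j (shift (s + 1) r) (b (s + 1) j)) :
    Outputs p i r (π ((List.range' 1 T).map b).reverse ((List.range' 0 (T + 1)).map r)) := by
  suffices h : Evaluates (fun m => some (r m)) (groundedBot ε i c) (.cons (p i) (opponents p i))
      (.atom ⟨i, π ((List.range' 1 T).map b).reverse ((List.range' 0 (T + 1)).map r)⟩) by
    rw [← hp] at h
    exact h
  unfold groundedBot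
  have hstart : Evaluates (fun m => some (r m)) (start ε) (.cons (p i) (opponents p i))
      (loopState p i r T b T) := by
    have h1 := (evaluates_findT hT hlt (.cons (p i) (opponents p i))).cons
      (Evaluates.arg (r := fun m => some (r m)) (x := .cons (p i) (opponents p i)))
    refine Evaluates.comp h1 ?_
    have h2 := Evaluates.arg.car.cons ((Evaluates.quote .nil).cons
      ((Evaluates.list_map (r := fun m => some (r m)) (l := [()]) (f := fun _ => read (car Code.arg))
        (g := fun _ => .num (r T))
        (x := .cons (.num (T : ℝ)) (.cons (p i) (opponents p i)))
        (fun _ _ => Evaluates.arg.car.read rfl)).cons Evaluates.arg.cdr))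
    have e : loopState p i r T b T = .cons (.num T) (.cons .nil
        (.cons (.ofList [.num (r T)]) (.cons (p i) (opponents p i)))) := by
      simp [loopState, Data.ofList]
    rw [e]
    exact h2
  refine Evaluates.comp (Evaluates.comp hstart (evaluates_main_loop hb le_rfl)) ?_
  refine Evaluates.eval (.quote c) (Evaluates.arg.cdr.car.cons Evaluates.arg.cdr.cdr.car) ?_
  have h := hc (fun m => some (r m)) ((List.range' 1 T).map b).reverse
    ((List.range' 0 (T + 1)).map r) (by simp)
  simpa [historyData, Evaluates, List.map_map, Function.comp_def] using h

end Bots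

/-! ## Sampling from a finite distribution -/

section Sampling

open Code

/-- Sample from the list of weighted outcomes `l` with the help of a number `x`; the default `d` is
returned if `x` is at least the total weight. -/
noncomputable def sample {β : Type*} (d : β) : List (β × ℝ) → ℝ → β
  | [], _ => d
  | (b, w) :: l, x => if x < w then b else sample d l (x - w)

/-- Code for `sample`. -/
noncomputable def sampleCode {α : Type u} {β : Type*} (e : β → Data α) (d : β) :
    List (β × ℝ) → Data α
  | [] => quote (e d)
  | (b, w) :: l => cond (lt arg (quote (.num w))) (quote (e b))
      (comp (sampleCode e d l) (sub arg (quote (.num w))))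

theorem evaluates_sampleCode {α : Type u} {β : Type*} (e : β → Data α) (d : β)
    (r : ℕ → Option ℝ) (l : List (β × ℝ)) (x : ℝ) :
    Evaluates r (sampleCode e d l) (.num x) (e (sample d l x)) := by
  classical
  induction l generalizing x with
  | nil => exact .quote _
  | cons q l ih =>
    rw [sample, apply_ite e]
    exact Evaluates.cond_ofBool (Evaluates.arg.lt (.quote _)) (fun _ => .quote _)
      fun _ => Evaluates.comp (Evaluates.arg.sub (.quote _)) (ih _)

theorem measurable_sample {β : Type*} [MeasurableSpace β] (d : β) (l : List (β × ℝ)) :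
    Measurable (sample d l) := by
  induction l with
  | nil => exact measurable_const
  | cons q l ih =>
    exact Measurable.ite measurableSet_Iio measurable_const (ih.comp (measurable_id.sub_const _))

end Sampling

/-! ## The grim trigger policy -/

section GrimTrigger

open Code

variable {n : ℕ} {A : Fin n → Type u}

open Classical in
/-- The action after the profile `a` is observed in a period with random number `x`: it is `pun i`
for the first player `i` in `l` who did not play `f i x`, and `t` if there is none. -/
noncomputable def grimUpdate {β : Type*} (f : ∀ j, ℝ → A j) (pun : Fin n → β) (l : List (Fin n))
    (t : β) (a : ∀ j, A j) (x : ℝ) : β :=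
  l.foldr (fun i s => if a i = f i x then s else pun i) t

theorem grimUpdate_of_forall_eq {β : Type*} {f : ∀ j, ℝ → A j} {pun : Fin n → β}
    {l : List (Fin n)} {t : β} {a : ∀ j, A j} {x : ℝ} (h : ∀ j, a j = f j x) :
    grimUpdate f pun l t a x = t := by
  induction l with
  | nil => rfl
  | cons j l ih =>
    rw [grimUpdate, List.foldr_cons, if_pos (h j)]
    exact ih

theorem grimUpdate_of_deviation {β : Type*} {f : ∀ j, ℝ → A j} {pun : Fin n → β}
    {l : List (Fin n)} {t : β} {a : ∀ j, A j} {x : ℝ} {i : Fin n}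
    (h : ∀ j, j ≠ i → a j = f j x) (hi : a i ≠ f i x) (hl : i ∈ l) :
    grimUpdate f pun l t a x = pun i := by
  induction l with
  | nil => simp at hl
  | cons j l ih =>
    rw [grimUpdate, List.foldr_cons]
    by_cases hj : j = i
    · subst hj
      rw [if_neg hi]
    · rw [if_pos (h j hj)]
      exact ih (by simpa [Ne.symm hj] using hl)

/-- The policy that follows `f` as long as everybody does, and switches to `pun i` for ever if
player `i` is the first to deviate. -/
noncomputable def grimPolicy (f : ∀ j, ℝ → A j) (j : Fin n) (pun : Fin n → A j) : Policy A j :=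
  -- The most recent period is processed first and each deviation overwrites the current choice, so
  -- the earliest deviation decides. The default `0` is irrelevant, as `rs` has an entry `r_0`.
  fun h rs => (h.reverse.zip rs.tail).foldl
    (fun t q => grimUpdate f pun (List.finRange n) t q.1 q.2) (f j (rs.headD 0))

/-- Code for `grimUpdate`, acting on `(t, (hist, rs))`. -/
def grimUpdateCode (cf : Fin n → Program A) (j : Fin n) (pun : Fin n → A j) (l : List (Fin n)) :
    Program A :=
  l.foldr (fun (i : Fin n) s => Code.cond (Data.cons (.op .eq) (Data.cons
    (nth i (car (car (cdr arg)))) (comp (cf i) (car (cdr (cdr arg)))))) s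
      (quote (.atom ⟨j, pun i⟩))) (car arg)

/-- Code for one step of the computation of `grimPolicy`. -/
def grimStepCode (cf : Fin n → Program A) (j : Fin n) (pun : Fin n → A j) : Program A :=
  cons (grimUpdateCode cf j pun (List.finRange n))
    (cons (cdr (car (cdr arg))) (cdr (cdr (cdr arg))))

/-- Code for `grimPolicy`. -/
def grimCode (cf : Fin n → Program A) (j : Fin n) (pun : Fin n → A j) : Program A :=
  comp (car arg) (comp (loop (.cons (.op .isPair) (car (cdr arg))) (grimStepCode cf j pun))
    (cons (comp (cf j) (car (cdr arg))) (cons (car arg) (cdr (cdr arg)))))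

variable {f : ∀ j, ℝ → A j} {cf : Fin n → Program A}

theorem evaluates_grimUpdateCode
    (hf : ∀ r j x, Evaluates r (cf j) (.num x) (.atom ⟨j, f j x⟩)) (r : ℕ → Option ℝ)
    {j : Fin n} {pun : Fin n → A j} (l : List (Fin n)) (t : A j) (a : ∀ j, A j) (x : ℝ)
    (h rs : Program A) :
    Evaluates r (grimUpdateCode cf j pun l)
      (.cons (.atom ⟨j, t⟩) (.cons (.cons (profileData a) h) (.cons (.num x) rs)))
      (.atom ⟨j, grimUpdate f pun l t a x⟩) := by
  classical
  induction l with
  | nil => exact Evaluates.arg.car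
  | cons i l ih =>
    have h1 : Evaluates r (nth i (car (car (cdr arg))))
        (.cons (.atom ⟨j, t⟩) (.cons (.cons (profileData a) h) (.cons (.num x) rs)))
        (.atom ⟨i, a i⟩) := by
      refine Evaluates.nth (l := (List.finRange n).map fun j => Data.atom ⟨j, a j⟩)
        (Evaluates.arg.cdr.car.car : Evaluates r _ _ (profileData a)) ?_
      rw [List.getElem?_map, List.getElem?_eq_getElem (by simp), List.getElem_finRange]
      rfl
    have e : (.atom ⟨j, grimUpdate f pun (i :: l) t a x⟩ : Program A) =
        if (.atom ⟨i, a i⟩ : Program A) = .atom ⟨i, f i x⟩ then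
          .atom ⟨j, grimUpdate f pun l t a x⟩ else .atom ⟨j, pun i⟩ := by
      simp only [grimUpdate, List.foldr_cons]
      by_cases hi : a i = f i x
      · rw [if_pos hi, if_pos (by rw [hi])]
      · rw [if_neg hi, if_neg (by simpa using hi)]
    rw [e]
    exact Evaluates.cond_ofBool (h1.eq (.comp Evaluates.arg.cdr.cdr.car (hf r i x)))
      (fun _ => ih) fun _ => Evaluates.quote _

theorem computesPolicy_grimCode
    (hf : ∀ r j x, Evaluates r (cf j) (.num x) (.atom ⟨j, f j x⟩)) (j : Fin n)
    (pun : Fin n → A j) : ComputesPolicy (grimCode cf j pun) (grimPolicy f j pun) := by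
  intro r h rs hlen
  obtain _ | ⟨x, rs⟩ := rs
  · simp at hlen
  replace hlen : rs.length = h.reverse.length := by simpa using hlen
  change Evaluates _ _ _ _
  unfold grimPolicy historyData
  simp only [List.tail_cons, List.headD_cons]
  generalize h.reverse = h at hlen ⊢
  have hloop : ∀ t : A j, Evaluates r
      (loop (Data.cons (.op .isPair) (car (cdr arg))) (grimStepCode cf j pun))
      (.cons (.atom ⟨j, t⟩) (.cons (.ofList (h.map profileData)) (.ofList (rs.map .num))))
      (.cons (.atom ⟨j, (h.zip rs).foldl
        (fun t q => grimUpdate f pun (List.finRange n) t q.1 q.2) t⟩) (.cons .nil .nil)) := by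
    intro t
    induction h generalizing rs t with
    | nil =>
      obtain rfl : rs = [] := by simpa using hlen
      refine Evaluates.loop_done ?_
      simpa [Data.isPair, Data.ofBool, Data.ofList] using
        (Evaluates.arg.cdr.car : Evaluates r (car (cdr arg))
          (.cons (.atom ⟨j, t⟩) (.cons .nil .nil) : Program A) .nil).isPair
    | cons a h ih =>
      obtain _ | ⟨x, rs⟩ := rs
      · simp at hlen
      refine Evaluates.loop_step (Evaluates.arg.cdr.car.isPair) (by simp [Data.isPair, Data.ofBool,
        Data.ofList]) ((evaluates_grimUpdateCode hf r _ t a x _ _).cons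
          (Evaluates.arg.cdr.car.cdr.cons Evaluates.arg.cdr.cdr.cdr)) ?_
      exact ih rs (by simpa using hlen) _
  exact Evaluates.comp (Evaluates.comp ((Evaluates.comp Evaluates.arg.cdr.car (hf r j x)).cons
    (Evaluates.arg.car.cons Evaluates.arg.cdr.cdr)) (hloop _)) Evaluates.arg.car

end GrimTrigger

/-! ## Measurability of the results of programs -/

section Measurability

/-- The possible labels of a node of a tree, with reals erased. -/
inductive Label (α : Type u) : Type u
  | atom (a : α)
  | op (o : Op)
  | num
  | nil
  | cons

instance (α : Type u) : MeasurableSpace (Label α) := ⊤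

instance (α : Type u) : DiscreteMeasurableSpace (Label α) := ⟨fun _ => trivial⟩

instance : Countable Op :=
  Function.Injective.countable (f := Op.ctorIdx) fun a b h => by
    cases a <;> cases b <;> first | rfl | cases h

instance (α : Type u) [Countable α] : Countable (Label α) :=
  Function.Surjective.countable
    (f := Sum.elim Label.atom (Sum.elim Label.op ![Label.num, Label.nil, Label.cons]))
    fun l => match l with
      | .atom a => ⟨.inl a, rfl⟩
      | .op o => ⟨.inr (.inl o), rfl⟩
      | .num => ⟨.inr (.inr 0), rfl⟩
      | .nil => ⟨.inr (.inr 1), rfl⟩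
      | .cons => ⟨.inr (.inr 2), rfl⟩

instance : MeasurableSpace Op := ⊤

instance : DiscreteMeasurableSpace Op := ⟨fun _ => trivial⟩

/-! ### The σ-algebra on trees -/

namespace Data

variable {α : Type u}

/-- The label of the node with a given address, together with the real that it carries. -/
def node : List Bool → Data α → Label α × ℝ
  | [], atom a => (.atom a, 0)
  | [], num x => (.num, x)
  | [], op o => (.op o, 0)
  | [], nil => (.nil, 0)
  | [], cons _ _ => (.cons, 0)
  | false :: l, cons x _ => node l x
  | true :: l, cons _ y => node l y
  | _ :: _, _ => (.nil, 0)

theorem ext_node {c d : Data α} (h : ∀ l, node l c = node l d) : c = d := by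
  induction c generalizing d with
  | cons x y hx hy =>
    cases d with
    | cons x' y' => rw [hx fun l => h (false :: l), hy fun l => h (true :: l)]
    | _ => simpa [node] using h []
  | _ => cases d <;> first | rfl | simpa [node] using h []

/-- A tree is identified with the family of its node labels. There are only countably many
addresses, which makes equality of trees measurable although trees carry real numbers. -/
instance : MeasurableSpace (Data α) :=
  MeasurableSpace.comap (fun d l => node l d) inferInstance

theorem measurable_node (l : List Bool) : Measurable (node l : Data α → Label α × ℝ) :=
  (measurable_pi_apply l).comp (comap_measurable fun (d : Data α) l => node l d)

variable {Ω : Type*} [MeasurableSpace Ω]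

theorem measurable_iff_node {f : Ω → Data α} :
    Measurable f ↔ ∀ l, Measurable fun ω => node l (f ω) := by
  refine ⟨fun h l => (measurable_node l).comp h, fun h => ?_⟩
  exact measurable_comap_iff.2 (measurable_pi_iff.2 h)

theorem measurableSet_eq [Countable α] {f g : Ω → Data α} (hf : Measurable f)
    (hg : Measurable g) : MeasurableSet {ω | f ω = g ω} := by
  have : {ω | f ω = g ω} = ⋂ l, {ω | node l (f ω) = node l (g ω)} := by
    ext ω
    simp only [Set.mem_ofPred_eq, Set.mem_iInter]
    exact ⟨fun h l => by rw [h], ext_node⟩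
  rw [this]
  refine MeasurableSet.iInter fun l => ?_
  have h1 := measurable_iff_node.1 hf l
  have h2 := measurable_iff_node.1 hg l
  have : {ω | node l (f ω) = node l (g ω)} =
      {ω | (node l (f ω)).1 = (node l (g ω)).1} ∩ {ω | (node l (f ω)).2 = (node l (g ω)).2} := by
    ext ω
    simp [Prod.ext_iff]
  rw [this]
  exact (measurableSet_eq_fun h1.fst h2.fst).inter (measurableSet_eq_fun h1.snd h2.snd)

/-- The data that are pairs. -/
def IsCons (d : Data α) : Prop := ∃ x y, d = cons x y

/-- The first component of a pair, and `nil` for other data. -/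
def carD : Data α → Data α
  | cons x _ => x
  | _ => nil

/-- The second component of a pair, and `nil` for other data. -/
def cdrD : Data α → Data α
  | cons _ y => y
  | _ => nil

/-- The instruction at the head of a pair, and `arg` if there is none. -/
def headOp : Data α → Op
  | cons (op o) _ => o
  | _ => .arg

/-- The real of a number, and `0` for other data. -/
def val : Data α → ℝ
  | num x => x
  | _ => 0

theorem node_nil (l : List Bool) : node l (nil : Data α) = (.nil, 0) := by
  cases l with
  | nil => rfl
  | cons b l => cases b <;> rfl

theorem measurable_carD : Measurable (carD : Data α → Data α) := by
  refine measurable_iff_node.2 fun l => ?_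
  have : (fun d : Data α => node l d.carD) = node (false :: l) := by
    funext d
    cases d <;> simp [carD, node, node_nil]
  rw [this]
  exact measurable_node _

theorem measurable_cdrD : Measurable (cdrD : Data α → Data α) := by
  refine measurable_iff_node.2 fun l => ?_
  have : (fun d : Data α => node l d.cdrD) = node (true :: l) := by
    funext d
    cases d <;> simp [cdrD, node, node_nil]
  rw [this]
  exact measurable_node _

theorem measurable_val : Measurable (val : Data α → ℝ) := by
  have : (val : Data α → ℝ) = fun d => (node [] d).2 := by
    funext d
    cases d <;> rfl
  rw [this]
  exact (measurable_node _).snd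

theorem measurable_headOp [Countable α] : Measurable (headOp : Data α → Op) := by
  let F : Label α → Op := fun l => match l with
    | .op o => o
    | _ => .arg
  have : (headOp : Data α → Op) = fun d => F (node [false] d).1 := by
    funext d
    cases d with
    | cons x y => cases x <;> rfl
    | _ => rfl
  rw [this]
  exact (Measurable.of_discrete (f := F)).comp (measurable_node _).fst

theorem measurableSet_isCons : MeasurableSet {d : Data α | d.IsCons} := by
  have : {d : Data α | d.IsCons} = {d | (node [] d).1 = .cons} := by
    ext d
    cases d <;> simp [IsCons, node]
  rw [this]
  exact (measurable_node _).fst (MeasurableSet.of_discrete (s := {.cons}))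

theorem measurable_cons {f g : Ω → Data α} (hf : Measurable f) (hg : Measurable g) :
    Measurable fun ω => cons (f ω) (g ω) := by
  refine measurable_iff_node.2 fun l => ?_
  match l with
  | [] => exact measurable_const
  | false :: l => exact measurable_iff_node.1 hf l
  | true :: l => exact measurable_iff_node.1 hg l

theorem measurable_num {f : Ω → ℝ} (hf : Measurable f) :
    Measurable fun ω => (num (f ω) : Data α) := by
  refine measurable_iff_node.2 fun l => ?_
  match l with
  | [] => exact measurable_const.prodMk hf
  | false :: l => exact measurable_const
  | true :: l => exact measurable_const

theorem measurable_ofBool {p : Ω → Prop} [∀ ω, Decidable (p ω)] (hp : MeasurableSet {ω | p ω}) :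
    Measurable fun ω => (ofBool (decide (p ω)) : Data α) := by
  have : (fun ω => (ofBool (decide (p ω)) : Data α)) = fun ω => if p ω then num 1 else nil := by
    funext ω
    simp [ofBool]
  rw [this]
  exact Measurable.ite hp measurable_const measurable_const

end Data

/-- A partial function with measurable domain that is measurable on its domain. -/
def PMeasurable {Ω β : Type*} [MeasurableSpace Ω] [MeasurableSpace β] (f : Ω → Option β) : Prop :=
  ∃ (E : Set Ω) (g : Ω → β), MeasurableSet E ∧ Measurable g ∧
    (∀ ω ∈ E, f ω = some (g ω)) ∧ ∀ ω ∉ E, f ω = none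

namespace PMeasurable

variable {Ω β γ : Type*} [MeasurableSpace Ω] [MeasurableSpace β] [MeasurableSpace γ]

theorem some {g : Ω → β} (hg : Measurable g) : PMeasurable fun ω => some (g ω) :=
  ⟨Set.univ, g, MeasurableSet.univ, hg, fun _ _ => rfl, fun _ h => absurd trivial h⟩

theorem none [Inhabited β] : PMeasurable fun _ : Ω => (none : Option β) :=
  ⟨∅, fun _ => default, MeasurableSet.empty, measurable_const, fun _ h => absurd h id,
    fun _ _ => rfl⟩

/-- On its domain the first function agrees with a total measurable `g`, so the continuation need
only be tested along such `g`. -/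
theorem bind {f : Ω → Option β} {k : Ω → β → Option γ} (hf : PMeasurable f)
    (hk : ∀ g : Ω → β, Measurable g → PMeasurable fun ω => k ω (g ω)) :
    PMeasurable fun ω => (f ω).bind (k ω) := by
  obtain ⟨E, g, hE, hg, h1, h2⟩ := hf
  obtain ⟨E', g', hE', hg', h1', h2'⟩ := hk g hg
  refine ⟨E ∩ E', g', hE.inter hE', hg', fun ω hω => ?_, fun ω hω => ?_⟩
  · simp [h1 ω hω.1, h1' ω hω.2]
  · by_cases h : ω ∈ E
    · simp [h1 ω h, h2' ω fun h' => hω ⟨h, h'⟩]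
    · simp [h2 ω h]

theorem map {f : Ω → Option β} {h : β → γ} (hf : PMeasurable f) (hh : Measurable h) :
    PMeasurable fun ω => (f ω).map h := by
  simp only [Option.map_eq_bind]
  exact hf.bind fun g hg => some (hh.comp hg)

/-- Serves for the dispatch on a random instruction and for reading the sequence at a random index.
-/
theorem cases {ι : Type*} [Countable ι] [MeasurableSpace ι] [DiscreteMeasurableSpace ι]
    {κ : Ω → ι} (hκ : Measurable κ) {F : ι → Ω → Option β} (hF : ∀ i, PMeasurable (F i)) :
    PMeasurable fun ω => F (κ ω) ω := by
  choose E g hE hg h1 h2 using hF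
  refine ⟨{ω | ω ∈ E (κ ω)}, fun ω => g (κ ω) ω, ?_, ?_, fun ω hω => h1 _ _ hω,
    fun ω hω => h2 _ _ hω⟩
  · have : {ω | ω ∈ E (κ ω)} = ⋃ i, κ ⁻¹' {i} ∩ E i := by
      ext ω
      simp
    rw [this]
    exact MeasurableSet.iUnion fun i => (hκ (MeasurableSet.of_discrete)).inter (hE i)
  · intro s hs
    have : (fun ω => g (κ ω) ω) ⁻¹' s = ⋃ i, κ ⁻¹' {i} ∩ g i ⁻¹' s := by
      ext ω
      simp
    rw [this]
    exact MeasurableSet.iUnion fun i => (hκ (MeasurableSet.of_discrete)).inter (hg i hs)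

theorem ite {p : Ω → Prop} [∀ ω, Decidable (p ω)] (hp : MeasurableSet {ω | p ω})
    {f g : Ω → Option β} (hf : PMeasurable f) (hg : PMeasurable g) :
    PMeasurable fun ω => if p ω then f ω else g ω := by
  have hκ : Measurable fun ω => decide (p ω) := by
    have : (fun ω => decide (p ω)) = fun ω => if p ω then true else false := by
      funext ω
      by_cases h : p ω <;> simp [h]
    rw [this]
    exact Measurable.ite hp measurable_const measurable_const
  have := cases hκ (F := fun b ω => if b = true then f ω else g ω)
    (by rintro (_ | _) <;> simpa)
  simpa using this

theorem measurableSet_eq_some {f : Ω → Option β} (hf : PMeasurable f) {b : β}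
    (hb : MeasurableSet {b}) : MeasurableSet {ω | f ω = Option.some b} := by
  obtain ⟨E, g, hE, hg, h1, h2⟩ := hf
  have : {ω | f ω = Option.some b} = E ∩ g ⁻¹' {b} := by
    ext ω
    by_cases h : ω ∈ E
    · simp [h, h1 ω h]
    · simp [h, h2 ω h]
  rw [this]
  exact hE.inter (hg hb)

end PMeasurable

/-! ### Measurability of the interpreter -/

section Run

variable {α : Type u} {Ω : Type*} [MeasurableSpace Ω]

instance : Inhabited (Data α) := ⟨.nil⟩

theorem PMeasurable.car? {g : Ω → Data α} (hg : Measurable g) :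
    PMeasurable fun ω => (g ω).car? := by
  refine ⟨{ω | (g ω).IsCons}, fun ω => (g ω).carD, hg Data.measurableSet_isCons,
    Data.measurable_carD.comp hg, ?_, fun ω hω => ?_⟩
  · rintro ω ⟨x, y, h⟩
    simp [h, Data.car?, Data.carD]
  · cases h : g ω <;> simp_all [Data.IsCons, Data.car?]

theorem PMeasurable.cdr? {g : Ω → Data α} (hg : Measurable g) :
    PMeasurable fun ω => (g ω).cdr? := by
  refine ⟨{ω | (g ω).IsCons}, fun ω => (g ω).cdrD, hg Data.measurableSet_isCons,
    Data.measurable_cdrD.comp hg, ?_, fun ω hω => ?_⟩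
  · rintro ω ⟨x, y, h⟩
    simp [h, Data.cdr?, Data.cdrD]
  · cases h : g ω <;> simp_all [Data.IsCons, Data.cdr?]

theorem PMeasurable.num? {g : Ω → Data α} (hg : Measurable g) :
    PMeasurable fun ω => (g ω).num? := by
  refine ⟨{ω | ((g ω).node []).1 = .num}, fun ω => (g ω).val,
    ((Data.measurable_node []).comp hg).fst (MeasurableSet.of_discrete (s := {Label.num})),
    Data.measurable_val.comp hg, fun ω hω => ?_, fun ω hω => ?_⟩ <;>
  cases h : g ω <;> simp_all [Data.node, Data.num?, Data.val]

theorem Data.measurable_isPair : Measurable (Data.isPair : Data α → Data α) := by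
  classical
  have : (Data.isPair : Data α → Data α) = fun d => Data.ofBool (decide d.IsCons) := by
    funext d
    cases d <;> simp [Data.isPair, Data.IsCons]
  rw [this]
  exact Data.measurable_ofBool Data.measurableSet_isCons

theorem PMeasurable.onNums {F : ℝ → ℝ → Option (Data α)}
    (hF : ∀ y z : Ω → ℝ, Measurable y → Measurable z → PMeasurable fun ω => F (y ω) (z ω))
    {f g : Ω → Data α} (hf : Measurable f) (hg : Measurable g) :
    PMeasurable fun ω => Data.onNums F (f ω) (g ω) := by
  have : (fun ω => Data.onNums F (f ω) (g ω)) =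
      fun ω => (f ω).num?.bind fun y => (g ω).num?.bind fun z => F y z := by
    funext ω
    cases f ω <;> cases g ω <;> rfl
  rw [this]
  exact (PMeasurable.num? hf).bind fun y hy => (PMeasurable.num? hg).bind fun z hz => hF y z hy hz

open Classical in
/-- One step of `run`, for code that is a pair with the instruction `o` at its head. -/
noncomputable def runPair (k : ℕ) (r : ℕ → Option ℝ) (c x : Data α) (o : Op) :
    Option (Data α) :=
  let f := c.cdrD.carD
  let g := c.cdrD.cdrD
  let binary (F : Data α → Data α → Option (Data α)) : Option (Data α) :=
    if c.cdrD.IsCons then (run k r f x).bind fun a => (run k r g x).bind fun b => F a b else none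
  match o with
  | .quote => some c.cdrD
  | .car => (run k r c.cdrD x).bind Data.car?
  | .cdr => (run k r c.cdrD x).bind Data.cdr?
  | .isPair => (run k r c.cdrD x).map Data.isPair
  | .cons => binary fun a b => some (.cons a b)
  | .eq => binary fun a b => some (.ofBool (decide (a = b)))
  | .lt => binary (Data.onNums fun y z => some (.ofBool (decide (y < z))))
  | .add => binary (Data.onNums fun y z => some (.num (y + z)))
  | .sub => binary (Data.onNums fun y z => some (.num (y - z)))
  | .mul => binary (Data.onNums fun y z => some (.num (y * z)))
  | .div => binary (Data.onNums fun y z => if z = 0 then none else some (.num (y / z)))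
  | .read =>
      (run k r c.cdrD x).bind fun a => a.num?.bind fun t => (r ⌊t⌋₊).map .num
  | .cond => if c.cdrD.IsCons then if g.IsCons then
      (run k r f x).bind fun t => if t = .nil then run k r g.cdrD x else run k r g.carD x
      else none else none
  | .loop => if c.cdrD.IsCons then (run k r f x).bind fun t =>
      if t = .nil then some x else (run k r g x).bind fun y => run k r c y else none
  | .eval => binary (run k r)
  | .app => if c.cdrD.IsCons then if g.IsCons then
      (run k r f x).bind fun p => (run k r g.carD x).bind fun q =>
        run k (fun m => (run k r g.cdrD (.cons (.num m) x)).bind Data.num?) p (.cons p q)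
      else none else none
  | .arg => none

-- Replaces the nested pattern matching of `run` by a dispatch on a measurable function with
-- countably many values. Code without an instruction at its head gets the default `arg` from
-- `headOp`, for which `runPair` has no result.
open Classical in
theorem run_succ (k : ℕ) (r : ℕ → Option ℝ) (c x : Data α) :
    run (k + 1) r c x = if c = .op .arg then some x else runPair k r c x c.headOp := by
  cases c with
  | op o => cases o <;> simp [run, runPair, Data.headOp]
  | cons c d =>
    cases c with
    | op o =>
      cases o
      case cond => cases d with
        | cons d e => cases e <;> simp [run, runPair, Data.headOp, Data.cdrD, Data.carD, Data.IsCons]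
        | _ => simp [run, runPair, Data.headOp, Data.cdrD, Data.IsCons]
      case app => cases d with
        | cons d e => cases e <;> simp [run, runPair, Data.headOp, Data.cdrD, Data.carD, Data.IsCons]
        | _ => simp [run, runPair, Data.headOp, Data.cdrD, Data.IsCons]
      all_goals cases d <;> simp [run, runPair, Data.headOp, Data.cdrD, Data.carD, Data.IsCons]
    | _ => simp [run, runPair, Data.headOp]
  | _ => simp [run, runPair, Data.headOp]

/-- Code, input and sequence all have to vary with `ω`, because `eval` and `app` execute data and
sequences that were themselves computed from random numbers. Induction on the depth then covers
every instruction. -/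
theorem PMeasurable.run [Countable α] (k : ℕ) {r : Ω → ℕ → Option ℝ} {c x : Ω → Data α}
    (hr : ∀ m, PMeasurable fun ω => r ω m) (hc : Measurable c) (hx : Measurable x) :
    PMeasurable fun ω => run k (r ω) (c ω) (x ω) := by
  classical
  induction k generalizing r c x with
  | zero => exact PMeasurable.none
  | succ k ih =>
    simp only [run_succ]
    refine PMeasurable.ite (Data.measurableSet_eq hc measurable_const) (.some hx) ?_
    refine PMeasurable.cases (Data.measurable_headOp.comp hc)
      (F := fun o ω => runPair k (r ω) (c ω) (x ω) o) fun o => ?_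
    have hd := Data.measurable_cdrD.comp hc
    have hf := Data.measurable_carD.comp hd
    have hg := Data.measurable_cdrD.comp hd
    have hd' : MeasurableSet {ω | (c ω).cdrD.IsCons} := hd Data.measurableSet_isCons
    have hg' : MeasurableSet {ω | (c ω).cdrD.cdrD.IsCons} := hg Data.measurableSet_isCons
    have binary : ∀ F : Ω → Data α → Data α → Option (Data α),
        (∀ a b : Ω → Data α, Measurable a → Measurable b →
          PMeasurable fun ω => F ω (a ω) (b ω)) →
        PMeasurable fun ω => if (c ω).cdrD.IsCons then
          (ProgramGame.run k (r ω) (c ω).cdrD.carD (x ω)).bind fun a =>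
            (ProgramGame.run k (r ω) (c ω).cdrD.cdrD (x ω)).bind fun b => F ω a b else Option.none :=
      fun F hF => .ite hd' ((ih hr hf hx).bind fun a ha => (ih hr hg hx).bind fun b hb =>
        hF a b ha hb) .none
    have hnil : ∀ t : Ω → Data α, Measurable t → MeasurableSet {ω | t ω = .nil} :=
      fun t ht => Data.measurableSet_eq ht measurable_const
    match o with
    | .arg => exact .none
    | .quote => exact .some hd
    | .car => exact (ih hr hd hx).bind fun g hg => .car? hg
    | .cdr => exact (ih hr hd hx).bind fun g hg => .cdr? hg
    | .isPair => exact (ih hr hd hx).map Data.measurable_isPair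
    | .cons => exact binary _ fun a b ha hb => .some (Data.measurable_cons ha hb)
    | .eq => exact binary _ fun a b ha hb => .some (Data.measurable_ofBool
        (Data.measurableSet_eq ha hb))
    | .lt => exact binary _ fun a b ha hb => .onNums (fun y z hy hz =>
        .some (Data.measurable_ofBool (measurableSet_lt hy hz))) ha hb
    | .add => exact binary _ fun a b ha hb => .onNums (fun y z hy hz =>
        .some (Data.measurable_num (hy.add hz))) ha hb
    | .sub => exact binary _ fun a b ha hb => .onNums (fun y z hy hz =>
        .some (Data.measurable_num (hy.sub hz))) ha hb
    | .mul => exact binary _ fun a b ha hb => .onNums (fun y z hy hz =>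
        .some (Data.measurable_num (hy.mul hz))) ha hb
    | .div => exact binary _ fun a b ha hb => .onNums (fun y z hy hz =>
        .ite (measurableSet_eq_fun hz measurable_const) .none
          (.some (Data.measurable_num (hy.div hz)))) ha hb
    | .read =>
      exact (ih hr hd hx).bind fun a ha => (PMeasurable.num? ha).bind fun t ht =>
        PMeasurable.map (.cases (Nat.measurable_floor.comp ht) (F := fun m ω => r ω m) hr)
          (Data.measurable_num measurable_id)
    | .cond =>
      exact .ite hd' (.ite hg' ((ih hr hf hx).bind fun t ht => .ite (hnil t ht)
        (ih hr (Data.measurable_cdrD.comp hg) hx) (ih hr (Data.measurable_carD.comp hg) hx))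
        .none) .none
    | .loop =>
      exact .ite hd' ((ih hr hf hx).bind fun t ht => .ite (hnil t ht) (.some hx)
        ((ih hr hg hx).bind fun y hy => ih hr hc hy)) .none
    | .eval => exact binary _ fun a b ha hb => ih hr ha hb
    | .app =>
      exact .ite hd' (.ite hg' ((ih hr hf hx).bind fun p hp =>
        (ih hr (Data.measurable_carD.comp hg) hx).bind fun q hq =>
          ih (fun m => (ih hr (Data.measurable_cdrD.comp hg)
            (Data.measurable_cons measurable_const hx)).bind fun y hy => .num? hy)
            hp (Data.measurable_cons hp hq)) .none) .none

end Run

/-- Halting is a countable union over recursion depths. -/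
theorem measurableSet_outputs {n : ℕ} {A : Fin n → Type u} [∀ i, Countable (A i)]
    (p : Fin n → Program A) (i : Fin n) (a : A i) :
    MeasurableSet {r : ℕ → ℝ | Outputs p i r a} := by
  unfold Outputs
  rw [Set.ofPred_exists]
  refine MeasurableSet.iUnion fun k => ?_
  refine PMeasurable.measurableSet_eq_some (.run k (fun m => .some (measurable_pi_apply m))
    measurable_const measurable_const) ?_
  exact Data.measurableSet_eq measurable_id measurable_const

end Measurability

/-! ## Probabilistic facts -/

section Probability

/-- The uniform distribution on `[0,1]`. -/
noncomputable abbrev unif : Measure ℝ := (volume : Measure ℝ).restrict (Set.Icc 0 1)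

theorem integrable_of_finite_range {Ω β : Type*} [MeasurableSpace Ω] {μ : Measure Ω}
    [IsFiniteMeasure μ] [Finite β] [MeasurableSpace β] [MeasurableSingletonClass β] {F : Ω → β}
    (hF : Measurable F) (g : β → ℝ) : Integrable (fun ω => g (F ω)) μ :=
  (Integrable.of_finite (f := g) (μ := μ.map F)).comp_measurable hF

theorem integral_of_finite_range {Ω β : Type*} [MeasurableSpace Ω] {μ : Measure Ω}
    [IsFiniteMeasure μ] [Fintype β] [MeasurableSpace β] [MeasurableSingletonClass β] {F : Ω → β}
    (hF : Measurable F) (g : β → ℝ) :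
    ∫ ω, g (F ω) ∂μ = ∑ b, μ.real {ω | F ω = b} * g b := by
  rw [← integral_map (f := g) hF.aemeasurable
    (measurable_of_finite g).aestronglyMeasurable, integral_fintype Integrable.of_finite]
  refine Finset.sum_congr rfl fun b _ => ?_
  rw [map_measureReal_apply hF (measurableSet_singleton b), smul_eq_mul]
  rfl

/-- The outcomes occupy consecutive intervals whose lengths are their weights; splitting at the
first weight and translating reduces to the shorter list. -/
theorem integral_sample {β : Type*} [Finite β] [MeasurableSpace β] [MeasurableSingletonClass β]
    (d : β) (g : β → ℝ) (l : List (β × ℝ)) (hl : ∀ q ∈ l, 0 ≤ q.2) :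
    ∫ x in (0 : ℝ)..(l.map Prod.snd).sum, g (sample d l x) =
      (l.map fun q => q.2 * g q.1).sum := by
  have hint : ∀ (l : List (β × ℝ)) (a b : ℝ),
      IntervalIntegrable (fun x => g (sample d l x)) volume a b := fun l a b =>
    ⟨integrable_of_finite_range (measurable_sample d l) g,
      integrable_of_finite_range (measurable_sample d l) g⟩
  induction l with
  | nil => simp
  | cons q l ih =>
    obtain ⟨b, w⟩ := q
    have hw : 0 ≤ w := hl (b, w) (by simp)
    have hl' : ∀ q ∈ l, 0 ≤ q.2 := fun q hq => hl q (by simp [hq])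
    have hS : 0 ≤ (l.map Prod.snd).sum := List.sum_nonneg (by simpa using fun x y h => hl' (y, x) h)
    simp only [List.map_cons, List.sum_cons]
    rw [← intervalIntegral.integral_add_adjacent_intervals (hint _ 0 w) (hint _ w _), ← ih hl']
    congr 1
    · rw [intervalIntegral.integral_congr_Ioo_of_le (g := fun _ => g b) hw]
      · simp
      · intro x hx
        simp [sample, hx.2]
    · rw [intervalIntegral.integral_congr (g := fun x => g (sample d l (x - w)))]
      · rw [intervalIntegral.integral_comp_sub_right (fun x => g (sample d l x))]
        simp
      · intro x hx
        rw [Set.uIcc_of_le (by linarith)] at hx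
        simp [sample, not_lt.2 hx.1]

open Classical in
/-- A distribution on a finite set is the law of a function of a uniform random variable. -/
theorem integral_sample_stdSimplex {β : Type*} [Fintype β] [MeasurableSpace β]
    [MeasurableSingletonClass β] (d : β) (s : stdSimplex ℝ β) (g : β → ℝ) :
    ∫ x, g (sample d (Finset.univ.toList.map fun b => (b, s.1 b)) x) ∂unif = ∑ b, s.1 b * g b := by
  have h := integral_sample d g (Finset.univ.toList.map fun b => (b, s.1 b))
    (by simpa using s.2.1)
  rw [List.map_map, List.map_map] at h
  simp only [Function.comp_def, Finset.sum_map_toList] at h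
  rw [s.2.2, intervalIntegral.integral_of_le zero_le_one] at h
  rw [integral_Icc_eq_integral_Ioc, h]

theorem shift_shift {s t : ℕ} (r : ℕ → ℝ) : shift s (shift t r) = shift (t + s) r := by
  funext m
  simp [shift, add_assoc, add_comm s t]

theorem measurable_shift (s : ℕ) : Measurable (shift s) :=
  measurable_pi_lambda _ fun m => measurable_pi_apply (m + s)

/-- The first entry of an i.i.d. sequence is independent of the others, which form again an
i.i.d. sequence. -/
theorem measurePreserving_head_shift :
    MeasurePreserving (fun r : ℕ → ℝ => (r 0, shift 1 r)) seqLaw (unif.prod seqLaw) := by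
  let e : ℝ × (ℕ → ℝ) → ℕ → ℝ := fun q m => Nat.casesOn m q.1 q.2
  have he : Measurable e := by
    refine measurable_pi_lambda _ fun m => ?_
    cases m with
    | zero => exact measurable_fst
    | succ m => exact (measurable_pi_apply m).comp measurable_snd
  have hh : Measurable fun r : ℕ → ℝ => (r 0, shift 1 r) :=
    (measurable_pi_apply 0).prodMk (measurable_shift 1)
  have key : (unif.prod seqLaw).map e = seqLaw := by
    refine Measure.eq_infinitePi _ fun s t ht => ?_
    classical
    obtain ⟨N, hN⟩ : ∃ N, s ⊆ Finset.range (N + 1) :=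
      ⟨s.sup id, fun i hi => Finset.mem_range_succ_iff.2 (Finset.le_sup (f := id) hi)⟩
    -- Padding the finite box to an initial segment of indices lets its preimage under `e` split
    -- into the condition on the head and a box for the tail.
    let t' : ℕ → Set ℝ := fun i => if i ∈ s then t i else Set.univ
    have ht' : ∀ i, MeasurableSet (t' i) := fun i => by
      by_cases h : i ∈ s <;> simp [t', h, ht i]
    have h1 : Set.pi s t = Set.pi (Finset.range (N + 1)) t' := by
      ext r
      simp only [Set.mem_pi, SetLike.mem_coe, t']
      constructor
      · intro h i _
        split_ifs with hi
        · exact h i hi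
        · trivial
      · intro h i hi
        simpa [hi] using h i (hN hi)
    have h2 : ∏ i ∈ s, unif (t i) = ∏ i ∈ Finset.range (N + 1), unif (t' i) := by
      rw [← Finset.prod_subset hN fun i _ hi => by simp [t', hi]]
      exact Finset.prod_congr rfl fun i hi => by simp [t', hi]
    have h3 : e ⁻¹' (Set.pi (Finset.range (N + 1)) t') =
        t' 0 ×ˢ Set.pi (Finset.range N) fun i => t' (i + 1) := by
      ext ⟨x, r⟩
      simp only [Set.mem_preimage, Set.mem_pi, SetLike.mem_coe, Finset.mem_range, Set.mem_prod, e]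
      constructor
      · exact fun h => ⟨h 0 (by omega), fun i hi => h (i + 1) (by omega)⟩
      · rintro ⟨h0, h⟩ (_ | i) hi
        · exact h0
        · exact h i (by omega)
    rw [h2, h1, Measure.map_apply he
      (MeasurableSet.pi (Finset.countable_toSet _) fun i _ => ht' i), h3, Measure.prod_prod, seqLaw,
      Measure.infinitePi_pi _ fun i _ => ht' (i + 1), Finset.prod_range_succ', mul_comm]
  refine ⟨hh, ?_⟩
  conv_lhs => rw [← key]
  rw [Measure.map_map hh he]
  convert Measure.map_id
  funext q
  rfl

theorem measurePreserving_head : MeasurePreserving (fun r : ℕ → ℝ => r 0) seqLaw unif :=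
  measurePreserving_fst.comp measurePreserving_head_shift

theorem measurePreserving_shift (s : ℕ) : MeasurePreserving (shift s) seqLaw seqLaw := by
  induction s with
  | zero => exact MeasurePreserving.id _
  | succ s ih =>
    have h1 : MeasurePreserving (shift 1) seqLaw seqLaw :=
      measurePreserving_snd.comp measurePreserving_head_shift
    have : shift (s + 1) = shift 1 ∘ shift s := by
      funext r
      exact (shift_shift r).symm
    rw [this]
    exact h1.comp ih

theorem integral_head (g : ℝ → ℝ) (hg : Measurable g) :
    ∫ r, g (r 0) ∂seqLaw = ∫ x, g x ∂unif := by
  rw [← measurePreserving_head.map_eq, integral_map measurePreserving_head.measurable.aemeasurable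
    hg.aestronglyMeasurable]

theorem integral_head_mul_shift (g : ℝ → ℝ) (hg : Measurable g) (h : (ℕ → ℝ) → ℝ)
    (hh : Measurable h) :
    ∫ r, g (r 0) * h (shift 1 r) ∂seqLaw = (∫ x, g x ∂unif) * ∫ r, h r ∂seqLaw := by
  rw [← integral_prod_mul, ← measurePreserving_head_shift.map_eq,
    integral_map measurePreserving_head_shift.measurable.aemeasurable]
  exact ((hg.comp measurable_fst).mul (hh.comp measurable_snd)).aestronglyMeasurable

theorem unif_real_Iio {ε : ℝ} (h0 : 0 ≤ ε) (h1 : ε ≤ 1) : unif.real (Set.Iio ε) = ε := by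
  rw [measureReal_restrict_apply measurableSet_Iio]
  have : Set.Iio ε ∩ Set.Icc 0 1 = Set.Ico 0 ε := by
    ext x
    simp only [Set.mem_inter_iff, Set.mem_Iio, Set.mem_Icc, Set.mem_Ico]
    constructor
    · rintro ⟨a, b, c⟩
      exact ⟨b, a⟩
    · rintro ⟨a, b⟩
      exact ⟨b, a, by linarith⟩
  rw [this]
  simp [h0]

/-- The event `N` that no entry is below `ε` satisfies `P(N) = (1 - ε) P(N)`, by independence of
head and tail. -/
theorem ae_exists_lt {ε : ℝ} (h0 : 0 < ε) (h1 : ε < 1) :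
    ∀ᵐ r ∂seqLaw, ∃ t, r t < ε := by
  set N : Set (ℕ → ℝ) := {r | ∀ t, ε ≤ r t} with hN
  have hNm : MeasurableSet N := by
    rw [hN, Set.ofPred_forall]
    exact MeasurableSet.iInter fun t => measurableSet_le measurable_const (measurable_pi_apply t)
  have hle : seqLaw.real N = (1 - ε) * seqLaw.real N := by
    have h := integral_head_mul_shift ((Set.Ici ε).indicator 1)
      (measurable_one.indicator measurableSet_Ici) (N.indicator 1) (measurable_one.indicator hNm)
    rw [integral_indicator_one hNm, integral_indicator_one measurableSet_Ici, ← Set.compl_Iio,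
      measureReal_compl measurableSet_Iio, unif_real_Iio h0.le h1.le, probReal_univ] at h
    rw [← h, ← integral_indicator_one hNm]
    congr 1
    funext r
    have : r ∈ N ↔ ε ≤ r 0 ∧ shift 1 r ∈ N := by
      simp only [hN, Set.mem_ofPred_eq, shift]
      exact ⟨fun h => ⟨h 0, fun t => h _⟩, fun h t => by cases t with
        | zero => exact h.1
        | succ t => exact h.2 t⟩
    by_cases h1 : ε ≤ r 0 <;> by_cases h2 : shift 1 r ∈ N <;>
      simp [Set.indicator, this, h1, h2]
  have h0 : seqLaw.real N = 0 := by nlinarith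
  rw [ae_iff]
  have : {r : ℕ → ℝ | ¬ ∃ t, r t < ε} = N := by
    ext r
    simp [hN]
  rw [this]
  simpa [measureReal_def, ENNReal.toReal_eq_zero_iff] using h0

/-- The sequences such that one of the simulations carried out by an `ε`-grounded bot has an
outcome in `Y`. -/
def simulated (ε : ℝ) (Y : Set (ℕ → ℝ)) : Set (ℕ → ℝ) :=
  {r | ∃ s, (∀ t ≤ s, ε ≤ r t) ∧ shift (s + 1) r ∈ Y}

/-- Separates the condition on the first entry from that on the shifted sequence, which are
independent. -/
theorem mem_simulated_iff {ε : ℝ} {Y : Set (ℕ → ℝ)} {r : ℕ → ℝ} :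
    r ∈ simulated ε Y ↔ ε ≤ r 0 ∧ (shift 1 r ∈ Y ∨ shift 1 r ∈ simulated ε Y) := by
  constructor
  · rintro ⟨s, hs, hY⟩
    refine ⟨hs 0 (by omega), ?_⟩
    cases s with
    | zero => exact .inl hY
    | succ s =>
      refine .inr ⟨s, fun t ht => hs (t + 1) (by omega), ?_⟩
      rwa [shift_shift, add_comm 1]
  · rintro ⟨h0, h | ⟨s, hs, hY⟩⟩
    · exact ⟨0, fun t ht => by rwa [Nat.le_zero.1 ht], h⟩
    · refine ⟨s + 1, fun t ht => ?_, ?_⟩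
      · cases t with
        | zero => exact h0
        | succ t => exact hs t (by omega)
      · rwa [shift_shift, add_comm 1] at hY

theorem measurableSet_simulated (ε : ℝ) {Y : Set (ℕ → ℝ)} (hY : MeasurableSet Y) :
    MeasurableSet (simulated ε Y) := by
  unfold simulated
  simp only [Set.ofPred_exists, Set.ofPred_and, Set.ofPred_forall]
  exact MeasurableSet.iUnion fun s => (MeasurableSet.iInter fun t => MeasurableSet.iInter fun _ =>
    measurableSet_le measurable_const (measurable_pi_apply t)).inter (measurable_shift _ hY)

open Classical in
/-- If deviating gains at most `M` in the period of the first deviation `Y`, and the payoff is at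
most `m` in all later periods, then the deviation does not pay, if `ε` is small. -/
theorem integral_le_of_punishment {ε : ℝ} (h0 : 0 < ε) (h1 : ε < 1) {Y : Set (ℕ → ℝ)}
    (hY : MeasurableSet Y) {g : ℝ → ℝ} (hg : Measurable g) {m M C : ℝ}
    (hC : ∀ x, |g x - m| ≤ C) (hε : ε * (M + C) ≤ (∫ x, g x ∂unif) - m)
    {Φ : (ℕ → ℝ) → ℝ} (hΦ : Integrable Φ seqLaw)
    (hle : ∀ᵐ r ∂seqLaw, Φ r ≤ if r ∈ simulated ε Y then m else g (r 0) + if r ∈ Y then M else 0) :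
    ∫ r, Φ r ∂seqLaw ≤ ∫ x, g x ∂unif := by
  set X := simulated ε Y
  have hX : MeasurableSet X := measurableSet_simulated ε hY
  set Z := Y ∪ X with hZ
  have hZm : MeasurableSet Z := hY.union hX
  have hgi : Integrable g unif := by
    have : Integrable (fun x => g x - m) unif :=
      Integrable.of_bound (hg.sub_const m).aestronglyMeasurable C (.of_forall hC)
    refine (this.add (integrable_const m)).congr (.of_forall fun x => ?_)
    simp
  have hXi : ∀ r, X.indicator (1 : (ℕ → ℝ) → ℝ) r =
      (Set.Ici ε).indicator 1 (r 0) * Z.indicator 1 (shift 1 r) := fun r => by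
    have : r ∈ X ↔ ε ≤ r 0 ∧ shift 1 r ∈ Z := mem_simulated_iff
    by_cases h1 : ε ≤ r 0 <;> by_cases h2 : shift 1 r ∈ Z <;>
      simp [Set.indicator, this, h1, h2]
  have hIci : Measurable ((Set.Ici ε).indicator (1 : ℝ → ℝ)) :=
    measurable_one.indicator measurableSet_Ici
  have hZi : Measurable (Z.indicator (1 : (ℕ → ℝ) → ℝ)) := measurable_one.indicator hZm
  have hμX : seqLaw.real X = (1 - ε) * seqLaw.real Z := by
    have h := integral_head_mul_shift _ hIci _ hZi
    rw [integral_indicator_one hZm, integral_indicator_one measurableSet_Ici, ← Set.compl_Iio,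
      measureReal_compl measurableSet_Iio, unif_real_Iio h0.le h1.le, probReal_univ,
      Set.compl_Iio] at h
    rw [← h, ← integral_indicator_one hX]
    exact integral_congr_ae (.of_forall hXi)
  -- With `hμX`, deviations that go unpunished have probability `ε P(Z)`.
  have hμY : seqLaw.real (Y \ X) = seqLaw.real Z - seqLaw.real X := by
    have := measureReal_union (μ := seqLaw) (s₁ := Y \ X) (s₂ := X) Set.disjoint_sdiff_left hX
    rw [Set.sdiff_union_self] at this
    linarith
  set H : ℝ := ∫ x, (Set.Ici ε).indicator 1 x * (g x - m) ∂unif with hH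
  -- The number `r 0` determines both whether a simulation takes place and the prescribed actions,
  -- so `g (r 0)` is not independent of `r 0 ≥ ε`. Discarding `r 0 < ε` costs at most `ε C`.
  have hHle : (∫ x, g x ∂unif) - m - ε * C ≤ H := by
    have hs : Integrable (fun x => g x - m) unif := hgi.sub (integrable_const m)
    have hsε : Integrable (fun x => (Set.Iio ε).indicator (1 : ℝ → ℝ) x * C) unif :=
      ((integrable_const 1).indicator measurableSet_Iio).mul_const C
    have h2 : ∫ x, (g x - m - (Set.Iio ε).indicator 1 x * C) ∂unif ≤ H := by
      refine integral_mono (hs.sub hsε) ?_ ?_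
      · refine Integrable.of_bound (hIci.mul (hg.sub_const m)).aestronglyMeasurable C
          (.of_forall fun x => ?_)
        have := hC x
        by_cases h : ε ≤ x
        · simpa [Set.indicator, h] using this
        · simpa [Set.indicator, h] using (abs_nonneg _).trans this
      · intro x
        have := abs_le.1 (hC x)
        by_cases h : ε ≤ x
        · simp [Set.indicator, h, not_lt.2 h]
        · simp [Set.indicator, h, not_le.1 h, this.2]
    rw [integral_sub hs hsε, integral_sub hgi (integrable_const m), integral_mul_const,
      integral_indicator_one measurableSet_Iio, unif_real_Iio h0.le h1.le] at h2
    simpa using h2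
  have hgm : Measurable fun x => (Set.Ici ε).indicator 1 x * (g x - m) := hIci.mul (hg.sub_const m)
  have hgr : Integrable (fun r : ℕ → ℝ => g (r 0)) seqLaw :=
    measurePreserving_head.integrable_comp_of_integrable hgi
  have hpi : Integrable (fun r : ℕ → ℝ => ((Set.Ici ε).indicator 1 (r 0) * (g (r 0) - m)) *
      Z.indicator 1 (shift 1 r)) seqLaw := by
    refine Integrable.of_bound ((hgm.comp (measurable_pi_apply 0)).mul
      (hZi.comp (measurable_shift 1))).aestronglyMeasurable C (.of_forall fun r => ?_)
    have := hC (r 0)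
    have hC0 := (abs_nonneg _).trans this
    by_cases h1 : ε ≤ r 0 <;> by_cases h2 : shift 1 r ∈ Z <;>
      simp [Set.indicator, h1, h2, this, hC0]
  have hYi : Integrable (fun r => (Y \ X).indicator (1 : (ℕ → ℝ) → ℝ) r * M) seqLaw :=
    ((integrable_const 1).indicator (hY.diff hX)).mul_const M
  -- Punishment replaces `g (r 0)` by `m` on `X`, whose indicator is the product in `hXi`; the gain
  -- `M` survives only on `Y \ X`.
  have hbound : ∫ r, Φ r ∂seqLaw ≤ ∫ r, (g (r 0) - ((Set.Ici ε).indicator 1 (r 0) * (g (r 0) - m)) *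
      Z.indicator 1 (shift 1 r) + (Y \ X).indicator 1 r * M) ∂seqLaw := by
    refine integral_mono_ae hΦ ((hgr.sub hpi).add hYi) ?_
    filter_upwards [hle] with r hr
    refine hr.trans (le_of_eq ?_)
    have := hXi r
    rw [mul_right_comm, ← this]
    by_cases h1 : r ∈ X <;> by_cases h2 : r ∈ Y <;> simp [Set.indicator, h1, h2]
  have hgp : Integrable (fun r : ℕ → ℝ => g (r 0) -
      ((Set.Ici ε).indicator 1 (r 0) * (g (r 0) - m)) * Z.indicator 1 (shift 1 r)) seqLaw :=
    hgr.sub hpi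
  rw [integral_add hgp hYi, integral_sub hgr hpi, integral_mul_const,
    integral_head_mul_shift _ hgm _ hZi, integral_indicator_one hZm,
    integral_indicator_one (hY.diff hX), hμY, hμX, integral_head g hg, ← hH] at hbound
  have hz : 0 ≤ seqLaw.real Z := measureReal_nonneg
  have : 0 ≤ seqLaw.real Z * (H - ε * M) := mul_nonneg hz (by linarith)
  linarith

end Probability

/-! ## Separable utilities -/

section Separable

variable {n : ℕ} {A : Fin n → Type u} [∀ i, Fintype (A i)]

/-- Under a product distribution, the expectation of a separable function only depends on the
marginals. -/
theorem sum_prod_mul_sum (P : ∀ j, A j → ℝ) (hP : ∀ j, ∑ b, P j b = 1) (w : ∀ j, A j → ℝ) :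
    ∑ a : ∀ j, A j, (∏ j, P j (a j)) * ∑ j, w j (a j) = ∑ j, ∑ b, P j b * w j b := by
  classical
  simp only [Finset.mul_sum]
  rw [Finset.sum_comm]
  refine Finset.sum_congr rfl fun j _ => ?_
  -- Absorbing `w j` into the factor with index `j` makes the sum over profiles factorise; the other
  -- factors sum to one.
  have h : ∀ a : ∀ j, A j, (∏ k, P k (a k)) * w j (a j) =
      ∏ k, (P k (a k) * if k = j then w k (a k) else 1) := fun a => by
    rw [Finset.prod_mul_distrib, Finset.prod_ite_eq' Finset.univ j fun k => w k (a k)]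
    simp
  simp only [h]
  have h2 := Finset.prod_univ_sum (fun j => (Finset.univ : Finset (A j)))
    fun k b => P k b * if k = j then w k b else 1
  rw [Fintype.piFinset_univ] at h2
  rw [← h2, Finset.prod_eq_single j]
  · simp
  · intro k _ hk
    simp [hk, hP]
  · simp

theorem mixedUtility_eq {U : Fin n → (∀ j, A j) → ℝ} {w : Fin n → ∀ j, A j → ℝ}
    (hw : ∀ i a, U i a = ∑ j, w i j (a j)) (s : ∀ j, Strategy A j) (i : Fin n) :
    mixedUtility U s i = ∑ j, ∑ b, (s j).1 b * w i j b := by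
  rw [← sum_prod_mul_sum (fun j => (s j).1) (fun j => (s j).2.2)]
  refine Finset.sum_congr rfl fun a _ => ?_
  rw [hw, mul_comm]

/-- A lower bound for the minimax utility. -/
theorem le_minimax {U : Fin n → (∀ j, A j) → ℝ} {w : Fin n → ∀ j, A j → ℝ}
    (hw : ∀ i a, U i a = ∑ j, w i j (a j)) [Nonempty (∀ j, Strategy A j)] (i : Fin n)
    (pun : ∀ j, A j) (hpun : ∀ j b, w i j (pun j) ≤ w i j b) (a : A i) :
    ∑ j ∈ Finset.univ.erase i, w i j (pun j) + w i i a ≤ minimax U i := by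
  classical
  refine le_ciInf fun s => ?_
  refine le_trans ?_ (le_ciSup (Set.finite_range _).bddAbove a)
  rw [mixedUtility_eq hw, ← Finset.sum_erase_add _ _ (Finset.mem_univ i)]
  refine add_le_add (Finset.sum_le_sum fun j hj => ?_) (le_of_eq ?_)
  · rw [Function.update_of_ne (Finset.ne_of_mem_erase hj)]
    calc w i j (pun j) = ∑ b, (s j).1 b * w i j (pun j) := by
          rw [← Finset.sum_mul, (s j).2.2, one_mul]
      _ ≤ _ := Finset.sum_le_sum fun b _ =>
          mul_le_mul_of_nonneg_left (hpun j b) ((s j).2.1 b)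
  · rw [Function.update_self]
    simp [pureStrategy, Pi.single_apply]

end Separable

/-! ## Grounded bots with the grim trigger policy -/

section Equilibrium

variable {n : ℕ} {A : Fin n → Type u}

theorem Outputs.unique {p : Fin n → Program A} {i : Fin n} {r : ℕ → ℝ} {a b : A i}
    (ha : Outputs p i r a) (hb : Outputs p i r b) : a = b := by
  simpa using Evaluates.unique ha hb

theorem grimPolicy_apply (f : ∀ j, ℝ → A j) (j : Fin n) (pun : Fin n → A j)
    (b : ℕ → ∀ j, A j) (r : ℕ → ℝ) (T : ℕ) :
    grimPolicy f j pun ((List.range' 1 T).map b).reverse ((List.range' 0 (T + 1)).map r) =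
      ((List.range' 1 T).map fun s => (b s, r s)).foldl
        (fun t q => grimUpdate f pun (List.finRange n) t q.1 q.2) (f j (r 0)) := by
  rw [grimPolicy, List.reverse_reverse, List.range'_succ, List.map_cons, List.tail_cons,
    List.headD_cons, List.zip_map']

/-- A grounded bot with the grim trigger policy outputs the action determined by the outcomes of
its simulations. -/
theorem outputs_grimBot {ε : ℝ} {f : ∀ j, ℝ → A j} {cf : Fin n → Program A}
    (hf : ∀ r j x, Evaluates r (cf j) (.num x) (.atom ⟨j, f j x⟩)) {q : Fin n → Program A}
    {j : Fin n} {pun : Fin n → A j} (hq : q j = groundedBot ε j (grimCode cf j pun))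
    {r : ℕ → ℝ} {T : ℕ} (hT : r T < ε) (hlt : ∀ t < T, ε ≤ r t) {play : (ℕ → ℝ) → ∀ j, A j}
    (h : ∀ s < T, ∀ k, Outputs q k (shift (s + 1) r) (play (shift (s + 1) r) k)) :
    Outputs q j r (((List.range' 1 T).map fun s => (play (shift s r), r s)).foldl
      (fun t q => grimUpdate f pun (List.finRange n) t q.1 q.2) (f j (r 0))) := by
  rw [← grimPolicy_apply f j pun (fun s => play (shift s r))]
  exact outputs_groundedBot (computesPolicy_grimCode hf j pun) hq hT hlt
    (b := fun s => play (shift s r)) h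

theorem foldl_grimUpdate_follow {f : ∀ j, ℝ → A j} {j : Fin n} (pun : Fin n → A j)
    (l : List ((∀ j, A j) × ℝ)) (hl : ∀ q ∈ l, ∀ k, q.1 k = f k q.2) (t : A j) :
    l.foldl (fun t q => grimUpdate f pun (List.finRange n) t q.1 q.2) t = t := by
  induction l generalizing t with
  | nil => rfl
  | cons q l ih =>
    rw [List.foldl_cons, grimUpdate_of_forall_eq (hl q (by simp))]
    exact ih (fun q hq => hl q (by simp [hq])) t

/-- If all players submit grounded bots with the grim trigger policy, they follow `f`. -/
theorem outputs_of_grimBots {ε : ℝ} {f : ∀ j, ℝ → A j} {cf : Fin n → Program A}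
    (hf : ∀ r j x, Evaluates r (cf j) (.num x) (.atom ⟨j, f j x⟩)) {q : Fin n → Program A}
    {pun : ∀ j, Fin n → A j} (hq : ∀ j, q j = groundedBot ε j (grimCode cf j (pun j)))
    {r : ℕ → ℝ} (hr : ∃ t, r t < ε) (j : Fin n) : Outputs q j r (f j (r 0)) := by
  classical
  suffices h : ∀ (T : ℕ) (r : ℕ → ℝ), r T < ε → (∀ t < T, ε ≤ r t) →
      ∀ j, Outputs q j r (f j (r 0)) from
    h (Nat.find hr) r (Nat.find_spec hr) (fun t ht => not_lt.1 (Nat.find_min hr ht)) j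
  intro T
  -- Removing `s + 1` entries lowers the stopping time from `T` to `T - (s + 1)`, so the mutual
  -- simulations are well-founded.
  induction T using Nat.strong_induction_on with
  | _ T ih =>
    intro r hT hlt j
    have h := outputs_grimBot hf (hq j) hT hlt (play := fun r j => f j (r 0))
      fun s hs k => ih (T - (s + 1)) (by omega) (shift (s + 1) r)
        (by rwa [shift, Nat.sub_add_cancel hs]) (fun t ht => hlt _ (by omega)) k
    rwa [foldl_grimUpdate_follow] at h
    intro q hq k
    obtain ⟨s, -, rfl⟩ := List.mem_map.1 hq
    simp [shift]

/-- The event that player `i` does not follow `f`, if the action of player `i` is given by `d`. -/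
def deviation (f : ∀ j, ℝ → A j) (i : Fin n) (d : (ℕ → ℝ) → A i) : Set (ℕ → ℝ) :=
  {r | d r ≠ f i (r 0)}

open Classical in
/-- The actions of the players if player `i` plays according to `d`, and the others submit grounded
bots with the grim trigger policy. -/
noncomputable def grimPlay (ε : ℝ) (f : ∀ j, ℝ → A j) (pun : ∀ j, Fin n → A j) (i : Fin n)
    (d : (ℕ → ℝ) → A i) (r : ℕ → ℝ) : ∀ j, A j :=
  Function.update
    (fun j => if r ∈ simulated ε (deviation f i d) then pun j i else f j (r 0)) i (d r)

-- At the earliest deviation the others still follow `f`, so player `i` is the only one to blame. In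
-- later periods the punishers themselves depart from `f`, but the fold lets the earliest deviation
-- prevail, so they are not mistaken for deviators.
open Classical in
theorem foldl_grimUpdate_grimPlay {ε : ℝ} {f : ∀ j, ℝ → A j} {pun : ∀ j, Fin n → A j} {i : Fin n}
    {d : (ℕ → ℝ) → A i} {r : ℕ → ℝ} {T : ℕ} (hT : r T < ε) (hlt : ∀ t < T, ε ≤ r t) (j : Fin n)
    (t : A j) :
    ((List.range' 1 T).map fun s => (grimPlay ε f pun i d (shift s r), r s)).foldl
      (fun t q => grimUpdate f (pun j) (List.finRange n) t q.1 q.2) t =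
        if r ∈ simulated ε (deviation f i d) then pun j i else t := by
  induction T generalizing r t with
  | zero =>
    rw [if_neg]
    · rfl
    · exact fun h => absurd (mem_simulated_iff.1 h).1 (not_le.2 hT)
  | succ T ih =>
    have hl : ((List.range' 1 (T + 1)).map fun s => (grimPlay ε f pun i d (shift s r), r s)) =
        (grimPlay ε f pun i d (shift 1 r), r 1) ::
          (List.range' 1 T).map fun s =>
            (grimPlay ε f pun i d (shift s (shift 1 r)), shift 1 r s) := by
      rw [List.range'_succ, List.map_cons, ← List.map_add_range', List.map_map]
      congr 1
      refine List.map_congr_left fun s _ => ?_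
      simp only [Function.comp_apply, shift_shift]
      rw [shift, add_comm s 1]
    -- The older periods form the same fold for `shift 1 r`, started from the value updated by the
    -- most recent period.
    rw [hl, List.foldl_cons, ih (r := shift 1 r) hT fun t ht => hlt _ (by omega)]
    have h0 := hlt 0 (by omega)
    by_cases hX : shift 1 r ∈ simulated ε (deviation f i d)
    · rw [if_pos hX, if_pos (mem_simulated_iff.2 ⟨h0, .inr hX⟩)]
    · rw [if_neg hX]
      have hother : ∀ k, k ≠ i → grimPlay ε f pun i d (shift 1 r) k = f k (r 1) := fun k hk => by
        rw [grimPlay, Function.update_of_ne hk, if_neg hX]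
        rfl
      have hself : grimPlay ε f pun i d (shift 1 r) i = d (shift 1 r) := Function.update_self ..
      by_cases hY : shift 1 r ∈ deviation f i d
      · rw [if_pos (mem_simulated_iff.2 ⟨h0, .inl hY⟩)]
        exact grimUpdate_of_deviation hother (fun h => hY (hself.symm.trans h)) (List.mem_finRange i)
      · rw [if_neg fun h => (mem_simulated_iff.1 h).2.elim hY hX]
        refine grimUpdate_of_forall_eq fun k => ?_
        by_cases hk : k = i
        · subst hk
          exact hself.trans (not_not.1 hY)
        · exact hother k hk

/-- The outputs if all players except for player `i` submit grounded bots with the grim trigger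
policy. -/
theorem outputs_grimPlay {ε : ℝ} {f : ∀ j, ℝ → A j} {cf : Fin n → Program A}
    (hf : ∀ r j x, Evaluates r (cf j) (.num x) (.atom ⟨j, f j x⟩)) {q : Fin n → Program A}
    {pun : ∀ j, Fin n → A j} {i : Fin n}
    (hq : ∀ j, j ≠ i → q j = groundedBot ε j (grimCode cf j (pun j))) {d : (ℕ → ℝ) → A i}
    {r : ℕ → ℝ} (hd : ∀ s, Outputs q i (shift s r) (d (shift s r))) (hr : ∃ t, r t < ε)
    (j : Fin n) : Outputs q j r (grimPlay ε f pun i d r j) := by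
  classical
  suffices h : ∀ (T : ℕ) (r : ℕ → ℝ), r T < ε → (∀ t < T, ε ≤ r t) →
      (∀ s, Outputs q i (shift s r) (d (shift s r))) →
      ∀ j, Outputs q j r (grimPlay ε f pun i d r j) from
    h (Nat.find hr) r (Nat.find_spec hr) (fun t ht => not_lt.1 (Nat.find_min hr ht)) hd j
  intro T
  induction T using Nat.strong_induction_on with
  | _ T ih =>
    intro r hT hlt hd j
    by_cases hj : j = i
    · subst hj
      rw [grimPlay, Function.update_self]
      exact hd 0
    · have h := outputs_grimBot hf (hq j hj) hT hlt (play := grimPlay ε f pun i d)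
        fun s hs k => ih (T - (s + 1)) (by omega) (shift (s + 1) r)
          (by rwa [shift, Nat.sub_add_cancel hs]) (fun t ht => hlt _ (by omega))
          (fun t => by simpa [shift_shift] using hd (s + 1 + t)) k
      rw [foldl_grimUpdate_grimPlay hT hlt] at h
      rwa [grimPlay, Function.update_of_ne hj]

variable [∀ i, Fintype (A i)]

/-- The expected utility of a player with a separable utility is the same as if all programs
received the same random sequence. -/
theorem expectedUtility_eq_integral {U : Fin n → (∀ j, A j) → ℝ} {w : Fin n → ∀ j, A j → ℝ}
    (hw : ∀ i a, U i a = ∑ j, w i j (a j)) [∀ j, MeasurableSpace (A j)]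
    [∀ j, MeasurableSingletonClass (A j)] {q : Fin n → Program A} {play : (ℕ → ℝ) → ∀ j, A j}
    (hm : ∀ j, Measurable fun r => play r j) (h : ∀ j, ∀ᵐ r ∂seqLaw, Outputs q j r (play r j))
    (i : Fin n) : expectedUtility U q i = ∫ r, ∑ j, w i j (play r j) ∂seqLaw := by
  -- Independence of the sequences makes the outcome law the product of the marginals of `play`.
  have hP : ∀ a : ∀ j, A j, outcomeProb q a = ∏ j, seqLaw.real {r | play r j = a j} := fun a => by
    have h1 : {ω : Fin n → ℕ → ℝ | ∀ i, Outputs q i (ω i) (a i)} =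
        Set.pi Set.univ fun i => {r | Outputs q i r (a i)} := by
      ext ω
      simp
    rw [outcomeProb, h1, measureReal_def, Measure.pi_pi, ENNReal.toReal_prod]
    refine Finset.prod_congr rfl fun j _ => ?_
    refine congrArg ENNReal.toReal (measure_congr ?_)
    filter_upwards [h j] with r hr
    exact propext ⟨fun h => hr.unique h, fun h => h ▸ hr⟩
  have h1 : ∀ j, ∑ b, seqLaw.real {r | play r j = b} = 1 := fun j => by
    have := integral_of_finite_range (μ := seqLaw) (hm j) fun _ => (1 : ℝ)
    simpa using this.symm
  rw [integral_finsetSum _ fun j _ => integrable_of_finite_range (hm j) (w i j)]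
  simp only [integral_of_finite_range (hm _) (w i _)]
  rw [← sum_prod_mul_sum (fun j b => seqLaw.real {r | play r j = b}) h1]
  exact Finset.sum_congr rfl fun a _ => by rw [hP, hw]

/-- The output of a program is a measurable function of the random sequence. -/
theorem exists_measurable_output (q : Fin n → Program A) (i : Fin n) [Nonempty (A i)]
    [MeasurableSpace (A i)] :
    ∃ d : (ℕ → ℝ) → A i, Measurable d ∧
      ∀ r, (∃ a, Outputs q i r a) → Outputs q i r (d r) := by
  classical
  -- Where the program does not halt, one fixed action is chosen, so that the fibres of `d` are
  -- measurable.
  have hspec : ∀ r : ℕ → ℝ, ∃ a : A i,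
      ((∃ a, Outputs q i r a) → Outputs q i r a) ∧
        ((¬ ∃ a, Outputs q i r a) → a = Classical.arbitrary _) := fun r => by
    by_cases h : ∃ a, Outputs q i r a
    · exact ⟨h.choose, fun _ => h.choose_spec, fun h' => absurd h h'⟩
    · exact ⟨_, fun h' => absurd h' h, fun _ => rfl⟩
  choose d h1 h2 using hspec
  refine ⟨d, ?_, h1⟩
  have hm : ∀ b, MeasurableSet (d ⁻¹' {b}) := fun b => by
    have : d ⁻¹' {b} = {r | Outputs q i r b} ∪
        ((⋃ a, {r | Outputs q i r a})ᶜ ∩ {_r | b = Classical.arbitrary (A i)}) := by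
      ext r
      by_cases h : ∃ a, Outputs q i r a
      · have hr := h1 r h
        simp only [Set.mem_preimage, Set.mem_singleton_iff, Set.mem_union, Set.mem_inter_iff,
          Set.mem_compl_iff, Set.mem_iUnion, Set.mem_ofPred_eq, h, not_true, false_and, or_false]
        exact ⟨fun e => e ▸ hr, fun e => hr.unique e⟩
      · have hr := h2 r h
        simp only [Set.mem_preimage, Set.mem_singleton_iff, Set.mem_union, Set.mem_inter_iff,
          Set.mem_compl_iff, Set.mem_iUnion, Set.mem_ofPred_eq, h, not_false_iff, true_and, hr]
        exact ⟨fun e => .inr e.symm, fun e => e.elim (fun e => absurd ⟨b, e⟩ h) Eq.symm⟩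
    rw [this]
    exact (measurableSet_outputs q i b).union
      ((MeasurableSet.iUnion fun a => measurableSet_outputs q i a).compl.inter
        (MeasurableSet.const _))
  intro S _
  have : d ⁻¹' S = ⋃ b ∈ S, d ⁻¹' {b} := by
    ext r
    simp
  rw [this]
  exact MeasurableSet.biUnion (Set.to_countable S) fun b _ => hm b

/-- Deviating from the profile of grounded bots with the grim trigger policy does not pay, if `ε`
is small. -/
theorem expectedUtility_deviation_le {U : Fin n → (∀ j, A j) → ℝ} {w : Fin n → ∀ j, A j → ℝ}
    (hw : ∀ i a, U i a = ∑ j, w i j (a j)) [∀ j, MeasurableSpace (A j)]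
    [∀ j, MeasurableSingletonClass (A j)] [∀ j, Nonempty (A j)] {ε : ℝ} (h0 : 0 < ε) (h1 : ε < 1)
    {f : ∀ j, ℝ → A j} (hfm : ∀ j, Measurable (f j)) {cf : Fin n → Program A}
    (hf : ∀ r j x, Evaluates r (cf j) (.num x) (.atom ⟨j, f j x⟩)) {q : Fin n → Program A}
    {pun : ∀ j, Fin n → A j} {i : Fin n}
    (hq : ∀ j, j ≠ i → q j = groundedBot ε j (grimCode cf j (pun j)))
    (hhalt : ∀ᵐ r ∂seqLaw, ∃ a : A i, Outputs q i r a) {a : A i} (ha : ∀ b, w i i b ≤ w i i a)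
    {m M C : ℝ} (hm : m = ∑ j ∈ Finset.univ.erase i, w i j (pun j i) + w i i a)
    (hM : ∀ b, w i i a - w i i b ≤ M) (hC : ∀ a : ∀ j, A j, |∑ j, w i j (a j) - m| ≤ C)
    (hε : ε * (M + C) ≤ (∫ x, ∑ j, w i j (f j x) ∂unif) - m) :
    expectedUtility U q i ≤ ∫ x, ∑ j, w i j (f j x) ∂unif := by
  classical
  obtain ⟨d, hd, hdq⟩ := exists_measurable_output q i
  have hY : MeasurableSet (deviation f i d) :=
    (measurableSet_eq_fun hd ((hfm i).comp (measurable_pi_apply 0))).compl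
  have hX := measurableSet_simulated ε hY
  have hplay : ∀ j, Measurable fun r => grimPlay ε f pun i d r j := fun j => by
    by_cases hj : j = i
    · subst hj
      simpa [grimPlay] using hd
    · simp only [grimPlay, Function.update_of_ne hj]
      exact Measurable.ite hX measurable_const ((hfm j).comp (measurable_pi_apply 0))
  -- Every shift preserves the law, so almost sure halting carries over to all the countably many
  -- simulations at once.
  have hgood : ∀ᵐ r ∂seqLaw, ∀ s, Outputs q i (shift s r) (d (shift s r)) := by
    rw [ae_all_iff]
    intro s
    filter_upwards [(measurePreserving_shift s).quasiMeasurePreserving.ae hhalt] with r hr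
    exact hdq _ hr
  have hout : ∀ j, ∀ᵐ r ∂seqLaw, Outputs q j r (grimPlay ε f pun i d r j) := fun j => by
    filter_upwards [hgood, ae_exists_lt h0 h1] with r hr hr'
    exact outputs_grimPlay hf hq hr hr' j
  have hg : Measurable fun x => ∑ j, w i j (f j x) :=
    Finset.measurable_fun_sum _ fun j _ => (measurable_of_finite (w i j)).comp (hfm j)
  rw [expectedUtility_eq_integral hw hplay hout]
  refine integral_le_of_punishment h0 h1 hY hg (fun x => hC _) hε
    (integrable_finsetSum _ fun j _ => integrable_of_finite_range (hplay j) _)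
    (.of_forall fun r => ?_)
  rw [← Finset.sum_erase_add _ _ (Finset.mem_univ i)]
  have hself : grimPlay ε f pun i d r i = d r := Function.update_self ..
  rw [hself]
  by_cases h : r ∈ simulated ε (deviation f i d)
  · rw [if_pos h, hm]
    refine add_le_add (le_of_eq (Finset.sum_congr rfl fun j hj => ?_)) (ha _)
    rw [grimPlay, Function.update_of_ne (Finset.ne_of_mem_erase hj), if_pos h]
  · rw [if_neg h, ← Finset.sum_erase_add _ _ (Finset.mem_univ i), add_assoc]
    refine add_le_add (le_of_eq (Finset.sum_congr rfl fun j hj => ?_)) ?_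
    · rw [grimPlay, Function.update_of_ne (Finset.ne_of_mem_erase hj), if_neg h]
    · by_cases hYr : r ∈ deviation f i d
      · rw [if_pos hYr]
        -- The others still follow `f`, so only the term `w i i` changes, by at most `M`.
        linarith [ha (d r), hM (f i (r 0))]
      · rw [if_neg hYr, not_not.1 hYr, add_zero]

/-- A payoff vector that is feasible and strictly individually rational in a game with separable
utilities is attained in an equilibrium of grounded bots. -/
theorem exists_groundedBot_equilibrium (U : Fin n → (∀ j, A j) → ℝ) (hU : AdditivelySeparable U)
    (v : Fin n → ℝ) (hfeas : Feasible U v) (hrat : StrictlyIndividuallyRational U v) :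
    ∃ ε : ℝ, 0 < ε ∧ ε < 1 ∧ ∃ (π : ∀ i, Policy A i) (p : Fin n → Program A),
      (∀ i, IsGroundedBot ε (π i) (p i)) ∧ IsProgramEquilibrium U p ∧
        ∀ i, expectedUtility U p i = v i := by
  classical
  obtain ⟨w, hw⟩ := hU
  obtain ⟨s, hs⟩ := hfeas
  let : ∀ j, MeasurableSpace (A j) := fun _ => ⊤
  have : ∀ j, DiscreteMeasurableSpace (A j) := fun _ => ⟨fun _ => trivial⟩
  have : ∀ j, Nonempty (A j) := fun j => by
    by_contra h
    rw [not_nonempty_iff] at h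
    simpa using (s j).2.2
  have : Nonempty (∀ j, Strategy A j) := ⟨s⟩
  -- Only sampled at numbers at least 1, a null event for the uniform law.
  let dflt : ∀ j, A j := fun j => Classical.arbitrary _
  let l : ∀ j, List (A j × ℝ) := fun j => Finset.univ.toList.map fun b => (b, (s j).1 b)
  let f : ∀ j, ℝ → A j := fun j => sample (dflt j) (l j)
  let cf : Fin n → Program A := fun j => sampleCode (fun a => .atom ⟨j, a⟩) (dflt j) (l j)
  have hf : ∀ r j x, Evaluates r (cf j) (.num x) (.atom ⟨j, f j x⟩) := fun r j x =>
    evaluates_sampleCode _ _ r (l j) x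
  have hfm : ∀ j, Measurable (f j) := fun j => measurable_sample _ _
  have hv : ∀ i, ∫ x, ∑ j, w i j (f j x) ∂unif = v i := fun i => by
    rw [integral_finsetSum _ fun j _ => integrable_of_finite_range (hfm j) (w i j), hs,
      mixedUtility_eq hw]
    exact Finset.sum_congr rfl fun j _ => integral_sample_stdSimplex (dflt j) (s j) (w i j)
  -- By separability the worst action of `j` for `i`, and the best action `a i` of player `i`, do
  -- not depend on what anyone else plays.
  choose pun hpun using fun j i => Finite.exists_min (w i j)
  choose a ha using fun i => Finite.exists_max (w i i)
  let m : Fin n → ℝ := fun i => ∑ j ∈ Finset.univ.erase i, w i j (pun j i) + w i i (a i)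
  have hm : ∀ i, m i < v i := fun i =>
    (le_minimax hw i (fun j => pun j i) (fun j => hpun j i) (a i)).trans_lt (hrat i)
  have hM : ∀ i, ∃ M, ∀ b, w i i (a i) - w i i b ≤ M := fun i =>
    (Set.finite_range fun b => w i i (a i) - w i i b).bddAbove.imp fun M h b => h ⟨b, rfl⟩
  have hC : ∀ i, ∃ C, ∀ a : ∀ j, A j, |∑ j, w i j (a j) - m i| ≤ C := fun i =>
    (Set.finite_range fun a : ∀ j, A j => |∑ j, w i j (a j) - m i|).bddAbove.imp
      fun M h b => h ⟨b, rfl⟩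
  choose M hM using hM
  choose C hC using hC
  obtain ⟨ε, h0, h1, hε⟩ : ∃ ε : ℝ, 0 < ε ∧ ε < 1 ∧ ∀ i, ε * (M i + C i) ≤ v i - m i := by
    -- The left side tends to `0` and `v i - m i > 0`; finitely many players allow one common `ε`.
    have h2 : ∀ᶠ ε in nhdsWithin (0 : ℝ) (Set.Ioi 0), ∀ i, ε * (M i + C i) ≤ v i - m i := by
      rw [Filter.eventually_all]
      intro i
      have ht : Filter.Tendsto (fun ε : ℝ => ε * (M i + C i)) (nhdsWithin 0 (Set.Ioi 0))
          (nhds (0 * (M i + C i))) :=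
        (Continuous.tendsto (by fun_prop) 0).mono_left nhdsWithin_le_nhds
      rw [zero_mul] at ht
      exact ht.eventually (eventually_le_nhds (sub_pos.2 (hm i)))
    have h3 : Set.Ioo (0 : ℝ) 1 ∈ nhdsWithin (0 : ℝ) (Set.Ioi 0) := Ioo_mem_nhdsGT one_pos
    obtain ⟨ε, h, h'⟩ := (h2.and h3).exists
    exact ⟨ε, h'.1, h'.2, h⟩
  let p : Fin n → Program A := fun j => groundedBot ε j (grimCode cf j (pun j))
  have hout : ∀ j, ∀ᵐ r ∂seqLaw, Outputs p j r (f j (r 0)) := fun j => by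
    filter_upwards [ae_exists_lt h0 h1] with r hr
    exact outputs_of_grimBots hf (fun _ => rfl) hr j
  have hpv : ∀ i, expectedUtility U p i = v i := fun i => by
    rw [expectedUtility_eq_integral hw
      (fun j => (hfm j).comp (measurable_pi_apply 0)) hout, ← hv]
    exact integral_head (fun x => ∑ j, w i j (f j x))
      (Finset.measurable_fun_sum _ fun j _ => (measurable_of_finite (w i j)).comp (hfm j))
  refine ⟨ε, h0, h1, fun j => grimPolicy f j (pun j), p,
    fun j => ⟨_, computesPolicy_grimCode hf j (pun j), rfl⟩,
    ⟨fun i => (hout i).mono fun r hr => ⟨_, hr⟩, fun i p' hp' => ?_⟩, hpv⟩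
  rw [hpv, ← hv]
  exact expectedUtility_deviation_le hw h0 h1 hfm hf
    (fun j hj => Function.update_of_ne hj _ _) (hp' i) (ha i) rfl (hM i) (hC i)
    (by rw [hv]; exact hε i)

end Equilibrium

end ProgramGame

theorem mainTheorem4 {n : ℕ} (A : Fin n → Type*) [∀ i, Fintype (A i)]
    (U : Fin n → (∀ j, A j) → ℝ) (hU : ProgramGame.AdditivelySeparable U)
    (v : Fin n → ℝ) (hfeas : ProgramGame.Feasible U v)
    (hrat : ProgramGame.StrictlyIndividuallyRational U v) :
    ∃ ε : ℝ, 0 < ε ∧ ε < 1 ∧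
      ∃ (π : ∀ i, ProgramGame.Policy A i) (p : Fin n → ProgramGame.Program A),
        (∀ i, ProgramGame.IsGroundedBot ε (π i) (p i)) ∧
        ProgramGame.IsProgramEquilibrium U p ∧
        ∀ i, ProgramGame.expectedUtility U p i = v i :=
  ProgramGame.exists_groundedBot_equilibrium U hU v hfeas hrat
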